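/- Let $M$ be a smooth surface, let $\mathcal A\subset TM\setminus 0$ be a conic sub-bundle (a non-empty open set, invariant under positive scaling of tangent vectors, projecting onto $M$), and let $F:\mathcal A\to\mathbb R$ be a conic pseudo-Finsler metric, i.e. $F$ is smooth, positively homogeneous of degree $1$ in $y$, and $g_{ij}=\tfrac12\dot\partial_i\dot\partial_jF^2$ is non-degenerate on $\mathcal A$. Here $(x^i,y^i)$ are the coordinates on $TM$ induced by any chart of $M$, $\partial_i=\partial/\partial x^i$ and $\dot\partial_i=\partial/\partial y^i$. Put $\mathfrak g=\det(g_{ij})$, $\varepsilon=\operatorname{sgn}\mathfrak g=\pm1$, $\ell^i=y^i/F$, $\ell_i=\dot\partial_iF$, $(m^1,m^2)=\frac{\varepsilon}{\sqrt{\varepsilon\mathfrak g}}(-\ell_2,\ell_1)$ and $m_i=g_{ij}m^j$. Let $C_{ijk}=\tfrac12\dot\partial_kg_{ij}$, and let $\mathcal I$ be the main scalar, defined by $F\,C_{ijk}=\mathcal I\,m_im_jm_k$. Let $G^i=\tfrac14g^{ih}(y^r\partial_r\dot\partial_hF^2-\partial_hF^2)$ be the geodesic spray coefficients, $S=y^i\partial_i-2G^i\dot\partial_i$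 the geodesic spray, $\delta_i=\partial_i-(\dot\partial_iG^j)\dot\partial_j$, and let $\mathcal J=S(\mathcal I)$ be the Landsberg scalar. For a smooth function $f$ put $$f_{;2}=\varepsilon F(\dot\partial_if)m^i,\qquad f_{,1}=(\delta_if)\ell^i,\qquad f_{,2}=\varepsilon(\delta_if)m^i ,$$ iterated from left to right (so $f_{;2,1}=(f_{;2})_{,1}$). Let $\phi$ be a smooth function on $\mathcal A$, positively homogeneous of degree $0$ in $y$, with $F^2\big(\dot\partial_i\dot\partial_j\phi+(\dot\partial_i\phi)(\dot\partial_j\phi)\big)m^im^j+\varepsilon\neq0$ on $\mathcal A$, and let $\overline F=e^{\phi}F$ be the resulting anisotropic conformal change of $F$. Put $$\sigma=\phi_{;2;2}+\varepsilon\mathcal I\phi_{;2}+2(\phi_{;2})^2,\qquad \rho=\frac1{\sigma+\varepsilon-(\phi_{;2})^2},\qquad 2Q=\varepsilon\rho F^2\big(\phi_{;2}\phi_{,1}+\phi_{,1;2}-2\phi_{,2}\big).$$ Let $\overline{\mathcal J}=\overline S(\overline{\mathcal I})$ be the Landsberg scalar of $\overline F$, where $\overline{\mathcal I}$ and $\overline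 S$ are the main scalar and the geodesic spray of $\overline F$, formed in the same way. Then at every point of $\mathcal A$ at which $\varepsilon\rho>0$ (that is, at which $\overline F$ has the same signature $\varepsilon$ as $F$), $$F\overline{\mathcal J}=F\sqrt{\varepsilon\rho}\,\mathcal J+\frac{\sqrt{\varepsilon\rho}}{2\rho}\Big[(F^2\rho_{,1}-2\varepsilon Q\rho_{;2})\Big(\mathcal I+2\varepsilon\phi_{;2}+\frac{\varepsilon\rho_{;2}}{2\rho}\Big)+F^2\big(4\varepsilon\rho\,\phi_{;2,1}-\varepsilon\rho_{;2,1}\big)-2Q\big(2\varepsilon\rho\,\mathcal I_{;2}+4\rho\,\phi_{;2;2}-\rho_{;2;2}\big)\Big].$$ -/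

import Mathlib

open scoped Manifold ContDiff

noncomputable section

namespace FinslerSurface

/-- The model plane of a surface. -/
abbrev Plane : Type := EuclideanSpace ℝ (Fin 2)

/-! ### Coordinates

A point `p = (x, y) : Plane × Plane` stands for the tangent vector `y` at the point `x`, both written
in the natural coordinates `(x¹, x², y¹, y²)` induced by a chart.  All objects below are functions
of such a point. -/

/-- `∂ᵢ f`, the partial derivative in `xⁱ`. -/
def dX (i : Fin 2) (f : Plane × Plane → ℝ) (p : Plane × Plane) : ℝ :=
  fderiv ℝ f p (EuclideanSpace.single i 1, 0)

/-- `∂̇ᵢ f`, the partial derivative in `yⁱ`. -/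
def dY (i : Fin 2) (f : Plane × Plane → ℝ) (p : Plane × Plane) : ℝ :=
  fderiv ℝ f p (0, EuclideanSpace.single i 1)

section Metric

variable (F : Plane × Plane → ℝ)

/-- The metric tensor `gᵢⱼ = ½ ∂̇ᵢ ∂̇ⱼ F²`. -/
def metric (p : Plane × Plane) : Matrix (Fin 2) (Fin 2) ℝ :=
  Matrix.of fun i j => (1 / 2) * dY i (dY j (fun q => F q ^ 2)) p

/-- `𝔤 = det (gᵢⱼ)`. -/
def detMetric (p : Plane × Plane) : ℝ := (metric F p).det

/-- `ε = ±1`, the sign of `𝔤`. -/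
def eps (p : Plane × Plane) : ℝ := Real.sign (detMetric F p)

/-- `ℓⁱ = yⁱ / F`. -/
def ellUp (i : Fin 2) (p : Plane × Plane) : ℝ := p.2 i / F p

/-- `ℓᵢ = ∂̇ᵢ F`. -/
def ellDown (i : Fin 2) (p : Plane × Plane) : ℝ := dY i F p

/-- `(m¹, m²) = ε / √(ε 𝔤) · (-ℓ₂, ℓ₁)`. -/
def mUp (i : Fin 2) (p : Plane × Plane) : ℝ :=
  eps F p / √(eps F p * detMetric F p) * ![-ellDown F 1 p, ellDown F 0 p] i

/-- The Cartan tensor `Cᵢⱼₖ = ½ ∂̇ₖ gᵢⱼ`. -/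
def cartan (i j k : Fin 2) (p : Plane × Plane) : ℝ :=
  (1 / 2) * dY k (fun q => metric F q i j) p

/-- The main scalar `𝓘`, characterized by `F Cᵢⱼₖ = 𝓘 mᵢ mⱼ mₖ`.  As `Cᵢⱼₖ yᵏ = 0` and
`mⁱ mᵢ = ε` with `ε³ = ε`, this is the same as `𝓘 = ε F Cᵢⱼₖ mⁱ mʲ mᵏ`. -/
def mainScalar (p : Plane × Plane) : ℝ :=
  eps F p * F p *
    ∑ i, ∑ j, ∑ k, cartan F i j k p * mUp F i p * mUp F j p * mUp F k p

/-- The coefficients of the geodesic spray, `Gⁱ = ¼ gⁱʰ (yʳ ∂ᵣ ∂̇ₕ F² - ∂ₕ F²)`. -/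
def sprayCoeff (i : Fin 2) (p : Plane × Plane) : ℝ :=
  (1 / 4) * ∑ h, (metric F p)⁻¹ i h *
    ((∑ r, p.2 r * dX r (dY h (fun q => F q ^ 2)) p) - dX h (fun q => F q ^ 2) p)

/-- The geodesic spray as a derivation, `S(f) = yⁱ ∂ᵢ f - 2 Gⁱ ∂̇ᵢ f`. -/
def spray (f : Plane × Plane → ℝ) (p : Plane × Plane) : ℝ :=
  (∑ i, p.2 i * dX i f p) - 2 * ∑ i, sprayCoeff F i p * dY i f p

/-- `δᵢ f = ∂ᵢ f - Gʲᵢ ∂̇ⱼ f`, where `Gʲᵢ = ∂̇ᵢ Gʲ` is the Barthel connection. -/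
def delta (i : Fin 2) (f : Plane × Plane → ℝ) (p : Plane × Plane) : ℝ :=
  dX i f p - ∑ j, dY i (sprayCoeff F j) p * dY j f p

/-- The vertical scalar derivative `f_{;2} = ε F (∂̇ᵢ f) mⁱ`. -/
def v2 (f : Plane × Plane → ℝ) (p : Plane × Plane) : ℝ :=
  eps F p * F p * ∑ i, dY i f p * mUp F i p

/-- The horizontal scalar derivative `f_{,1} = (δᵢ f) ℓⁱ`. -/
def h1 (f : Plane × Plane → ℝ) (p : Plane × Plane) : ℝ :=
  ∑ i, delta F i f p * ellUp F i p

/-- The horizontal scalar derivative `f_{,2} = ε (δᵢ f) mⁱ`. -/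
def h2 (f : Plane × Plane → ℝ) (p : Plane × Plane) : ℝ :=
  eps F p * ∑ i, delta F i f p * mUp F i p

/-- The Landsberg scalar `𝓙 = S(𝓘)`. -/
def landsberg (p : Plane × Plane) : ℝ := spray F (mainScalar F) p

variable (φ : Plane × Plane → ℝ)

/-- `F² (∂̇ᵢ ∂̇ⱼ φ + (∂̇ᵢ φ) (∂̇ⱼ φ)) mⁱ mʲ + ε`. -/
def changeDiscriminant (p : Plane × Plane) : ℝ :=
  F p ^ 2 * (∑ i, ∑ j,
    (dY i (dY j φ) p + dY i φ p * dY j φ p) * mUp F i p * mUp F j p) + eps F p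

/-- `σ = φ_{;2;2} + ε 𝓘 φ_{;2} + 2 (φ_{;2})²`. -/
def sigma (p : Plane × Plane) : ℝ :=
  v2 F (v2 F φ) p + eps F p * mainScalar F p * v2 F φ p + 2 * v2 F φ p ^ 2

/-- `ρ = 1 / (σ + ε - (φ_{;2})²)`. -/
def rho (p : Plane × Plane) : ℝ :=
  1 / (sigma F φ p + eps F p - v2 F φ p ^ 2)

/-- `Q`, given by `2 Q = ε ρ F² (φ_{;2} φ_{,1} + φ_{,1;2} - 2 φ_{,2})`. -/
def Q (p : Plane × Plane) : ℝ :=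
  (1 / 2) * (eps F p * rho F φ p * F p ^ 2 *
    (v2 F φ p * h1 F φ p + v2 F (h1 F φ) p - 2 * h2 F φ p))

end Metric

/-! ### Surfaces -/

section Surface

variable {M : Type*} [TopologicalSpace M] [ChartedSpace Plane M]

/-- The tangent vector of `M` whose coordinates in the chart `e` are `p = (x, y)`. -/
def tangentVec (e : OpenPartialHomeomorph M Plane) (p : Plane × Plane) :
    TangentBundle (𝓡 2) M :=
  tangentMap (𝓡 2) (𝓡 2) e.symm (⟨p.1, p.2⟩ : TangentBundle (𝓡 2) Plane)

/-- The expression of a function on `TM` in the coordinates of the chart `e`. -/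
def inChart (e : OpenPartialHomeomorph M Plane) (f : TangentBundle (𝓡 2) M → ℝ) :
    Plane × Plane → ℝ :=
  fun p => f (tangentVec e p)

/-- `p` represents, in the chart `e`, an element of `A ⊆ TM`. -/
def IsCoord (e : OpenPartialHomeomorph M Plane) (A : Set (TangentBundle (𝓡 2) M))
    (p : Plane × Plane) : Prop :=
  p.1 ∈ e.target ∧ tangentVec e p ∈ A

/-- Positive homogeneity of integer degree `r` in the direction (`h(r)`) on `A`. -/
def IsPosHomogeneous (A : Set (TangentBundle (𝓡 2) M)) (r : ℕ)
    (f : TangentBundle (𝓡 2) M → ℝ) : Prop :=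
  ∀ u ∈ A, ∀ c : ℝ, 0 < c →
    f (⟨u.proj, c • u.snd⟩ : TangentBundle (𝓡 2) M) = c ^ r * f u

variable [IsManifold (𝓡 2) ∞ M]

/-- A conic sub-bundle of `TM`: a non-empty open set of non-zero tangent vectors, invariant under
positive scaling, that projects onto `M`. -/
structure IsConicSubbundle (A : Set (TangentBundle (𝓡 2) M)) : Prop where
  nonempty : A.Nonempty
  isOpen : IsOpen A
  ne_zero : ∀ u ∈ A, u.snd ≠ 0
  smul_mem : ∀ u ∈ A, ∀ c : ℝ, 0 < c → (⟨u.proj, c • u.snd⟩ : TangentBundle (𝓡 2) M) ∈ A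
  proj_surj : ∀ x : M, ∃ u ∈ A, u.proj = x

/-- `F : A → ℝ` is a conic pseudo-Finsler metric on the surface `M`.  (The values of `F` outside the
open set `A` play no role.) -/
structure IsConicPseudoFinsler (A : Set (TangentBundle (𝓡 2) M))
    (F : TangentBundle (𝓡 2) M → ℝ) : Prop where
  conic : IsConicSubbundle A
  smooth : ContMDiffOn (𝓡 2).tangent 𝓘(ℝ, ℝ) ∞ F A
  homogeneous : IsPosHomogeneous A 1 F
  nondegenerate : ∀ e ∈ IsManifold.maximalAtlas (𝓡 2) ∞ M, ∀ p, IsCoord e A p →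
    detMetric (inChart e F) p ≠ 0

/-- `φ` is the conformal factor of an anisotropic conformal change of `F`. -/
structure IsConformalFactor (A : Set (TangentBundle (𝓡 2) M))
    (F φ : TangentBundle (𝓡 2) M → ℝ) : Prop where
  smooth : ContMDiffOn (𝓡 2).tangent 𝓘(ℝ, ℝ) ∞ φ A
  homogeneous : IsPosHomogeneous A 0 φ
  discriminant_ne_zero : ∀ e ∈ IsManifold.maximalAtlas (𝓡 2) ∞ M, ∀ p, IsCoord e A p →
    changeDiscriminant (inChart e F) (inChart e φ) p ≠ 0

/-- The changed metric `F̄ = e^φ F`. -/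
def conformalChange (F φ : TangentBundle (𝓡 2) M → ℝ) : TangentBundle (𝓡 2) M → ℝ :=
  fun u => Real.exp (φ u) * F u

end Surface

end FinslerSurface

end

/-!
# The Landsberg scalar under an anisotropic conformal change

In a chart the statement concerns functions of `(x, y)` on a conic open set, smooth and homogeneous
in `y`, and Euler's theorem for such functions is the main tool. With `n = (-y², y¹)`, a function of
degree `0` has vertical gradient proportional to `n`, and the Hessian of a function `F` of degree
`1` is `(𝔤 / F³) n ⊗ n` (`cube_mul_hessian`). The argument has two halves.

*The main scalar.* For every metric, `𝓘 = ½ F mᵏ ∂̇ₖ log |𝔤|` (`IsFinsler.mainScalar_mul_det`).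
Contracting the Hessians of `F̄ = e^φ F` and `F` with `m` gives `𝔤̄ = ε ρ⁻¹ e^{4φ} 𝔤`
(`IsFinsler.detMetric_exp_mul`), where `ρ⁻¹` is identified through the formula for `φ_{;2;2}`
(`IsFinsler.v2_v2`). On functions of degree `0` the vertical derivative of `F̄` is `√(ε ρ)` times
that of `F` (`IsFinsler.v2_exp_mul`). Together these yield
`𝓘̄ = √(ε ρ) (𝓘 + 2 ε φ_{;2} - ε ρ_{;2} / (2 ρ))` (`IsFinsler.mainScalar_exp_mul`).

*The spray.* The Euler–Lagrange equations `S(∂̇ᵢ F) = ∂ᵢ F`, written for `F` and for `F̄`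
and contracted with `m`, show that `Ḡ - G = Q m` up to a multiple of `y`
(`IsFinsler.perp_mul_sprayCoeff_sub`). Hence `F S̄(f) = F² f_{,1} - 2 ε Q f_{;2}` for `f` of
degree `0` (`IsFinsler.mul_spray_exp_mul`).

Applying the second formula to `f = 𝓘̄` and using the first gives the result
(`IsFinsler.landsberg_exp_mul`). The sign `ε` is constant near the given point, and
`ε ρ > 0` there makes `F̄` a metric of the same signature near it.
-/

open scoped Manifold ContDiff

noncomputable section

namespace FinslerSurface

/-! ### Coordinates on the tangent bundle -/

section Coordinates

variable {M : Type*} [TopologicalSpace M] [ChartedSpace Plane M]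

theorem contMDiff_tangentBundle_mk : ContMDiff 𝓘(ℝ, Plane × Plane) (𝓡 2).tangent ∞
    (fun p : Plane × Plane => (⟨p.1, p.2⟩ : TangentBundle (𝓡 2) Plane)) := by
  have h := contMDiff_tangentBundleModelSpaceHomeomorph_symm (I := 𝓡 2) (n := ∞)
  rw [tangentBundleModelSpaceHomeomorph_coe_symm] at h
  rw [modelWithCornersSelf_prod]
  exact h

theorem tangentVec_smul (e : OpenPartialHomeomorph M Plane) (p : Plane × Plane) (c : ℝ) :
    tangentVec e (p.1, c • p.2) =
      (⟨(tangentVec e p).proj, c • (tangentVec e p).snd⟩ : TangentBundle (𝓡 2) M) := by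
  simp only [tangentVec, tangentMap]
  congr 1
  exact map_smul (mfderiv (𝓡 2) (𝓡 2) e.symm p.1) c p.2

variable [IsManifold (𝓡 2) ∞ M]

theorem contMDiffOn_tangentVec {e : OpenPartialHomeomorph M Plane}
    (he : e ∈ IsManifold.maximalAtlas (𝓡 2) ∞ M) :
    ContMDiffOn 𝓘(ℝ, Plane × Plane) (𝓡 2).tangent ∞ (tangentVec e) {p | p.1 ∈ e.target} := by
  have hs := contMDiffOn_symm_of_mem_maximalAtlas he
  have hmap := hs.contMDiffOn_tangentMapWithin (m := ∞) (by simp) e.open_target.uniqueMDiffOn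
  have heq : ∀ v ∈ Bundle.TotalSpace.proj ⁻¹' e.target,
      tangentMap (𝓡 2) (𝓡 2) e.symm v = tangentMapWithin (𝓡 2) (𝓡 2) e.symm e.target v :=
    fun v hv => (tangentMapWithin_eq_tangentMap (e.open_target.uniqueMDiffOn v.1 hv)
      ((hs.contMDiffAt (e.open_target.mem_nhds hv)).mdifferentiableAt (by simp))).symm
  exact (hmap.congr heq).comp (t := Bundle.TotalSpace.proj ⁻¹' e.target)
    contMDiff_tangentBundle_mk.contMDiffOn fun p hp => hp

theorem isOpen_setOf_isCoord {e : OpenPartialHomeomorph M Plane}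
    (he : e ∈ IsManifold.maximalAtlas (𝓡 2) ∞ M) {A : Set (TangentBundle (𝓡 2) M)}
    (hA : IsOpen A) : IsOpen {p | IsCoord e A p} :=
  (contMDiffOn_tangentVec he).continuousOn.isOpen_inter_preimage
    (e.open_target.preimage continuous_fst) hA

theorem contDiffOn_inChart {e : OpenPartialHomeomorph M Plane}
    (he : e ∈ IsManifold.maximalAtlas (𝓡 2) ∞ M) {A : Set (TangentBundle (𝓡 2) M)}
    {f : TangentBundle (𝓡 2) M → ℝ} (hf : ContMDiffOn (𝓡 2).tangent 𝓘(ℝ, ℝ) ∞ f A) :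
    ContDiffOn ℝ ∞ (inChart e f) {p | IsCoord e A p} :=
  contMDiffOn_iff_contDiffOn.1
    (hf.comp ((contMDiffOn_tangentVec he).mono fun _ hp => hp.1) fun _ hp => hp.2)

end Coordinates

/-! ### Smooth homogeneous functions on a conic open set -/

/-- An open set of points `(x, y)` that is invariant under positive scaling of `y`. -/
structure IsConicOpen (U : Set (Plane × Plane)) : Prop where
  isOpen : IsOpen U
  smul_mem : ∀ q ∈ U, ∀ c : ℝ, 0 < c → (q.1, c • q.2) ∈ U

/-- `f` is smooth on `U` and positively homogeneous of integer degree `r` in `y` there. -/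
structure IsHomog (U : Set (Plane × Plane)) (r : ℤ) (f : Plane × Plane → ℝ) : Prop where
  smooth : ContDiffOn ℝ ∞ f U
  smul : ∀ q ∈ U, ∀ c : ℝ, 0 < c → f (q.1, c • q.2) = c ^ r * f q

variable {U : Set (Plane × Plane)} {r s : ℤ} {f g : Plane × Plane → ℝ} {q : Plane × Plane}

theorem fderiv_eq_of_eqOn (hU : IsConicOpen U) (h : Set.EqOn f g U) (hq : q ∈ U) :
    fderiv ℝ f q = fderiv ℝ g q :=
  (h.eventuallyEq_of_mem (hU.isOpen.mem_nhds hq)).fderiv_eq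

theorem dX_eq_of_eqOn (hU : IsConicOpen U) (h : Set.EqOn f g U) (hq : q ∈ U) (i : Fin 2) :
    dX i f q = dX i g q := by
  rw [dX, dX, fderiv_eq_of_eqOn hU h hq]

theorem dY_eq_of_eqOn (hU : IsConicOpen U) (h : Set.EqOn f g U) (hq : q ∈ U) (i : Fin 2) :
    dY i f q = dY i g q := by
  rw [dY, dY, fderiv_eq_of_eqOn hU h hq]

theorem contDiffOn_fderiv_apply (hU : IsConicOpen U) (hf : ContDiffOn ℝ ∞ f U)
    (v : Plane × Plane) : ContDiffOn ℝ ∞ (fun q => fderiv ℝ f q v) U :=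
  (hf.fderiv_of_isOpen hU.isOpen (by simp)).clm_apply contDiffOn_const

/-- Partial derivatives of a smooth function commute. -/
theorem fderiv_fderiv_comm (hU : IsConicOpen U) (hf : ContDiffOn ℝ ∞ f U) (hq : q ∈ U)
    (v w : Plane × Plane) :
    fderiv ℝ (fun p => fderiv ℝ f p v) q w = fderiv ℝ (fun p => fderiv ℝ f p w) q v := by
  have hd : DifferentiableAt ℝ (fderiv ℝ f) q :=
    ((hf.fderiv_of_isOpen hU.isOpen (m := ∞) (by simp)).contDiffAt
      (hU.isOpen.mem_nhds hq)).differentiableAt (by simp)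
  have hsymm : IsSymmSndFDerivAt ℝ f q :=
    (hf.contDiffAt (hU.isOpen.mem_nhds hq)).isSymmSndFDerivAt (by
      rw [minSmoothness_of_isRCLikeNormedField]; exact WithTop.coe_le_coe.2 le_top)
  rw [fderiv_clm_apply hd (differentiableAt_const v),
    fderiv_clm_apply hd (differentiableAt_const w)]
  simpa using hsymm w v

/-- The scaling `(x, y) ↦ (x, c y)`. -/
def fiberScale (c : ℝ) : (Plane × Plane) →L[ℝ] (Plane × Plane) :=
  (ContinuousLinearMap.id ℝ Plane).prodMap (c • ContinuousLinearMap.id ℝ Plane)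

@[simp]
theorem fiberScale_apply (c : ℝ) (q : Plane × Plane) : fiberScale c q = (q.1, c • q.2) := rfl

namespace IsHomog

theorem differentiableAt (hU : IsConicOpen U) (hf : IsHomog U r f) (hq : q ∈ U) :
    DifferentiableAt ℝ f q :=
  (hf.smooth.contDiffAt (hU.isOpen.mem_nhds hq)).differentiableAt (by simp)

theorem congr (hU : IsConicOpen U) (hf : IsHomog U r f) (h : Set.EqOn g f U) : IsHomog U r g where
  smooth := hf.smooth.congr h
  smul q hq c hc := by rw [h hq, h (hU.smul_mem q hq c hc), hf.smul q hq c hc]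

theorem congr_deg (hf : IsHomog U r f) (h : r = s) : IsHomog U s f := h ▸ hf

theorem mono {V : Set (Plane × Plane)} (hf : IsHomog U r f) (h : V ⊆ U) : IsHomog V r f :=
  ⟨hf.smooth.mono h, fun q hq => hf.smul q (h hq)⟩

theorem const (a : ℝ) : IsHomog U 0 fun _ => a :=
  ⟨contDiffOn_const, by simp⟩

theorem coord (i : Fin 2) : IsHomog U 1 fun q => q.2 i where
  smooth := by fun_prop
  smul := by simp

theorem add (hf : IsHomog U r f) (hg : IsHomog U r g) : IsHomog U r fun q => f q + g q where
  smooth := hf.smooth.add hg.smooth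
  smul q hq c hc := by simp only [hf.smul q hq c hc, hg.smul q hq c hc, mul_add]

theorem neg (hf : IsHomog U r f) : IsHomog U r fun q => -f q where
  smooth := hf.smooth.neg
  smul q hq c hc := by simp only [hf.smul q hq c hc, mul_neg]

theorem sub (hf : IsHomog U r f) (hg : IsHomog U r g) : IsHomog U r fun q => f q - g q where
  smooth := hf.smooth.sub hg.smooth
  smul q hq c hc := by simp only [hf.smul q hq c hc, hg.smul q hq c hc, mul_sub]

theorem sum {ι : Type*} {t : Finset ι} {f : ι → Plane × Plane → ℝ}
    (hf : ∀ i ∈ t, IsHomog U r (f i)) : IsHomog U r fun q => ∑ i ∈ t, f i q where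
  smooth := ContDiffOn.sum fun i hi => (hf i hi).smooth
  smul q hq c hc := by
    rw [Finset.mul_sum]
    exact Finset.sum_congr rfl fun i hi => (hf i hi).smul q hq c hc

theorem mul (hf : IsHomog U r f) (hg : IsHomog U s g) :
    IsHomog U (r + s) fun q => f q * g q where
  smooth := hf.smooth.mul hg.smooth
  smul q hq c hc := by
    simp only [hf.smul q hq c hc, hg.smul q hq c hc, zpow_add₀ hc.ne']
    ring

theorem pow (hf : IsHomog U r f) (n : ℕ) : IsHomog U (n * r) fun q => f q ^ n where
  smooth := hf.smooth.pow n
  smul q hq c hc := by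
    simp only [hf.smul q hq c hc, mul_pow]
    rw [mul_comm (n : ℤ) r, zpow_mul, zpow_natCast]

theorem inv (hf : IsHomog U r f) (h0 : ∀ q ∈ U, f q ≠ 0) : IsHomog U (-r) fun q => (f q)⁻¹ where
  smooth := hf.smooth.inv h0
  smul q hq c hc := by simp only [hf.smul q hq c hc, mul_inv, zpow_neg]

theorem div (hf : IsHomog U r f) (hg : IsHomog U s g) (h0 : ∀ q ∈ U, g q ≠ 0) :
    IsHomog U (r - s) fun q => f q / g q := by
  simpa only [div_eq_mul_inv, sub_eq_add_neg] using hf.mul (hg.inv h0)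

theorem exp (hf : IsHomog U 0 f) : IsHomog U 0 fun q => Real.exp (f q) where
  smooth := hf.smooth.exp
  smul q hq c hc := by simp [hf.smul q hq c hc]

theorem sqrt (hf : IsHomog U 0 f) (h0 : ∀ q ∈ U, f q ≠ 0) : IsHomog U 0 fun q => √(f q) where
  smooth := hf.smooth.sqrt h0
  smul q hq c hc := by simp [hf.smul q hq c hc]

theorem fderiv_smul (hU : IsConicOpen U) (hf : IsHomog U r f) (hq : q ∈ U) {c : ℝ} (hc : 0 < c)
    (v w : Plane) : fderiv ℝ f (q.1, c • q.2) (v, c • w) = c ^ r * fderiv ℝ f q (v, w) := by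
  have h1 : fderiv ℝ (fun p => f (fiberScale c p)) q = fderiv ℝ (fun p => c ^ r * f p) q :=
    fderiv_eq_of_eqOn hU (fun p hp => hf.smul p hp c hc) hq
  have h2 : HasFDerivAt (fun p => f (fiberScale c p))
      ((fderiv ℝ f (q.1, c • q.2)).comp (fiberScale c)) q :=
    (hf.differentiableAt hU (hU.smul_mem q hq c hc)).hasFDerivAt.comp q (fiberScale c).hasFDerivAt
  rw [h2.fderiv, fderiv_const_mul (hf.differentiableAt hU hq)] at h1
  simpa using DFunLike.congr_fun h1 (v, w)

theorem dX (hU : IsConicOpen U) (hf : IsHomog U r f) (i : Fin 2) : IsHomog U r (dX i f) where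
  smooth := contDiffOn_fderiv_apply hU hf.smooth _
  smul q hq c hc := by
    simpa [FinslerSurface.dX] using hf.fderiv_smul hU hq hc (EuclideanSpace.single i 1) 0

theorem dY (hU : IsConicOpen U) (hf : IsHomog U r f) (i : Fin 2) :
    IsHomog U (r - 1) (dY i f) where
  smooth := contDiffOn_fderiv_apply hU hf.smooth _
  smul q hq c hc := by
    have h := hf.fderiv_smul hU hq hc 0 (c⁻¹ • EuclideanSpace.single i 1)
    rw [smul_inv_smul₀ hc.ne'] at h
    have h' : ((0 : Plane), c⁻¹ • (EuclideanSpace.single i 1 : Plane)) =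
        c⁻¹ • ((0 : Plane), (EuclideanSpace.single i 1 : Plane)) := by simp
    rw [h', map_smul, smul_eq_mul] at h
    rw [FinslerSurface.dY, h, zpow_sub_one₀ hc.ne', FinslerSurface.dY]
    ring

end IsHomog

theorem fderiv_eq_sum (f : Plane × Plane → ℝ) (q v : Plane × Plane) :
    fderiv ℝ f q v = (v.1 0 * dX 0 f q + v.1 1 * dX 1 f q) +
      (v.2 0 * dY 0 f q + v.2 1 * dY 1 f q) := by
  have hsingle : ∀ w : Plane, w = w 0 • EuclideanSpace.single 0 1 +
      w 1 • EuclideanSpace.single 1 1 := fun w => by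
    ext i; fin_cases i <;> simp
  have hv : v = (v.1 0 • ((EuclideanSpace.single 0 1 : Plane), (0 : Plane)) +
      v.1 1 • ((EuclideanSpace.single 1 1 : Plane), (0 : Plane))) +
      (v.2 0 • ((0 : Plane), (EuclideanSpace.single 0 1 : Plane)) +
      v.2 1 • ((0 : Plane), (EuclideanSpace.single 1 1 : Plane))) := by
    refine Prod.ext ?_ ?_
    · simpa using hsingle v.1
    · simpa using hsingle v.2
  conv_lhs => rw [hv]
  simp only [map_add, map_smul, smul_eq_mul]
  rfl

/-- Euler's theorem on homogeneous functions. -/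
theorem euler_of_isHomog (hU : IsConicOpen U) (hf : IsHomog U r f) (hq : q ∈ U) :
    q.2 0 * dY 0 f q + q.2 1 * dY 1 f q = r * f q := by
  have hcurve : HasDerivAt (fun c : ℝ => (q.1, c • q.2)) ((0 : Plane), q.2) 1 := by
    simpa using (hasDerivAt_const (1 : ℝ) q.1).prodMk ((hasDerivAt_id (1 : ℝ)).smul_const q.2)
  have hd : HasFDerivAt f (fderiv ℝ f q) ((fun c : ℝ => (q.1, c • q.2)) 1) := by
    simpa using (hf.differentiableAt hU hq).hasFDerivAt
  have h1 : HasDerivAt (fun c : ℝ => f (q.1, c • q.2)) (fderiv ℝ f q (0, q.2)) 1 :=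
    hd.comp_hasDerivAt 1 hcurve
  have h2 : HasDerivAt (fun c : ℝ => c ^ r * f q) (r * f q) 1 := by
    simpa using (hasDerivAt_zpow r 1 (Or.inl one_ne_zero)).mul_const (f q)
  have h3 : (fun c : ℝ => f (q.1, c • q.2)) =ᶠ[nhds 1] fun c => c ^ r * f q := by
    filter_upwards [lt_mem_nhds (zero_lt_one' ℝ)] with c hc using hf.smul q hq c hc
  have h4 := h1.unique (h2.congr_of_eventuallyEq h3)
  rw [fderiv_eq_sum] at h4
  simpa using h4

theorem dY_dY_comm (hU : IsConicOpen U) (hf : IsHomog U r f) (hq : q ∈ U) (i j : Fin 2) :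
    dY i (dY j f) q = dY j (dY i f) q :=
  fderiv_fderiv_comm hU hf.smooth hq _ _

theorem dX_dY_comm (hU : IsConicOpen U) (hf : IsHomog U r f) (hq : q ∈ U) (i j : Fin 2) :
    dX i (dY j f) q = dY j (dX i f) q :=
  fderiv_fderiv_comm hU hf.smooth hq _ _

/-! ### The metric tensor -/

theorem fderiv_mul_apply (hU : IsConicOpen U) (hf : IsHomog U r f) (hg : IsHomog U s g)
    (hq : q ∈ U) (v : Plane × Plane) : fderiv ℝ (fun p => f p * g p) q v =
      fderiv ℝ f q v * g q + f q * fderiv ℝ g q v := by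
  rw [fderiv_fun_mul (hf.differentiableAt hU hq) (hg.differentiableAt hU hq)]
  simp only [add_apply, smul_apply, smul_eq_mul]
  ring

theorem dX_mul (hU : IsConicOpen U) (hf : IsHomog U r f) (hg : IsHomog U s g) (hq : q ∈ U)
    (i : Fin 2) : dX i (fun p => f p * g p) q = dX i f q * g q + f q * dX i g q :=
  fderiv_mul_apply hU hf hg hq _

theorem dY_mul (hU : IsConicOpen U) (hf : IsHomog U r f) (hg : IsHomog U s g) (hq : q ∈ U)
    (i : Fin 2) : dY i (fun p => f p * g p) q = dY i f q * g q + f q * dY i g q :=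
  fderiv_mul_apply hU hf hg hq _

theorem dY_add (hU : IsConicOpen U) (hf : IsHomog U r f) (hg : IsHomog U s g) (hq : q ∈ U)
    (i : Fin 2) : dY i (fun p => f p + g p) q = dY i f q + dY i g q :=
  DFunLike.congr_fun (fderiv_fun_add (hf.differentiableAt hU hq) (hg.differentiableAt hU hq)) _

theorem dY_sub (hU : IsConicOpen U) (hf : IsHomog U r f) (hg : IsHomog U s g) (hq : q ∈ U)
    (i : Fin 2) : dY i (fun p => f p - g p) q = dY i f q - dY i g q :=
  DFunLike.congr_fun (fderiv_fun_sub (hf.differentiableAt hU hq) (hg.differentiableAt hU hq)) _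

@[simp]
theorem dY_const (a : ℝ) (i : Fin 2) : dY i (fun _ => a) q = 0 := by simp [dY]

theorem dY_sq (hU : IsConicOpen U) (hf : IsHomog U r f) (hq : q ∈ U) (i : Fin 2) :
    dY i (fun p => f p ^ 2) q = 2 * (f q * dY i f q) := by
  have h := dY_mul hU hf hf hq i
  simp only [← sq] at h
  rw [h]; ring

theorem dX_sq (hU : IsConicOpen U) (hf : IsHomog U r f) (hq : q ∈ U) (i : Fin 2) :
    dX i (fun p => f p ^ 2) q = 2 * (f q * dX i f q) := by
  have h := dX_mul hU hf hf hq i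
  simp only [← sq] at h
  rw [h]; ring

theorem dY_dY_sq (hU : IsConicOpen U) (hf : IsHomog U r f) (hq : q ∈ U) (i j : Fin 2) :
    dY i (dY j fun p => f p ^ 2) q = 2 * (dY i f q * dY j f q + f q * dY i (dY j f) q) := by
  rw [dY_eq_of_eqOn hU (fun p hp => dY_sq hU hf hp j) hq i,
    dY_mul hU (IsHomog.const 2) (hf.mul (hf.dY hU j)) hq i, dY_mul hU hf (hf.dY hU j) hq i]
  simp [dY]

theorem dX_dY_sq (hU : IsConicOpen U) (hf : IsHomog U r f) (hq : q ∈ U) (i j : Fin 2) :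
    dX i (dY j fun p => f p ^ 2) q = 2 * (dX i f q * dY j f q + f q * dX i (dY j f) q) := by
  rw [dX_eq_of_eqOn hU (fun p hp => dY_sq hU hf hp j) hq i,
    dX_mul hU (IsHomog.const 2) (hf.mul (hf.dY hU j)) hq i, dX_mul hU hf (hf.dY hU j) hq i]
  simp [dX]

variable {F φ : Plane × Plane → ℝ} {ε : ℝ}

theorem metric_apply (hU : IsConicOpen U) (hF : IsHomog U 1 F) (hq : q ∈ U) (i j : Fin 2) :
    metric F q i j = dY i F q * dY j F q + F q * dY i (dY j F) q := by
  rw [metric, Matrix.of_apply, dY_dY_sq hU hF hq]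
  ring

theorem isHomog_metric (hU : IsConicOpen U) (hF : IsHomog U 1 F) (i j : Fin 2) :
    IsHomog U 0 fun q => metric F q i j :=
  ((IsHomog.const (1 / 2)).mul (((hF.pow 2).dY hU j).dY hU i)).congr_deg (by norm_num)

theorem isHomog_detMetric (hU : IsConicOpen U) (hF : IsHomog U 1 F) :
    IsHomog U 0 (detMetric F) := by
  have h := isHomog_metric hU hF
  refine (((h 0 0).mul (h 1 1)).sub ((h 0 1).mul (h 1 0))).congr hU fun q _ => ?_
  rw [detMetric, Matrix.det_fin_two]

/-- The vector `(-y², y¹)`, which spans the annihilator of `y`. -/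
def perp (q : Plane × Plane) : Fin 2 → ℝ := ![-q.2 1, q.2 0]

/-- As `(∂̇ᵢ ∂̇ⱼ F) yʲ = 0`, the Hessian of `F` is a multiple of `n ⊗ n` with `n = (-y², y¹)`; the
factor is determined by `𝔤`. -/
theorem cube_mul_hessian (hU : IsConicOpen U) (hF : IsHomog U 1 F) (hq : q ∈ U) (h0 : F q ≠ 0)
    (i j : Fin 2) :
    F q ^ 3 * dY i (dY j F) q = detMetric F q * (perp q i * perp q j) := by
  have e := euler_of_isHomog hU hF hq
  have e0 := euler_of_isHomog hU (hF.dY hU 0) hq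
  have e1 := euler_of_isHomog hU (hF.dY hU 1) hq
  have hs := dY_dY_comm hU hF hq 1 0
  have hdet : detMetric F q = metric F q 0 0 * metric F q 1 1 - metric F q 0 1 * metric F q 1 0 :=
    Matrix.det_fin_two _
  rw [hdet]
  simp only [metric_apply hU hF hq]
  rw [hs] at e0 ⊢
  norm_num at e e0 e1
  set a := q.2 0
  set b := q.2 1
  set A := dY 0 (dY 0 F) q
  set B := dY 0 (dY 1 F) q
  set C := dY 1 (dY 1 F) q
  have hn : a ^ 2 + b ^ 2 ≠ 0 := by
    intro hn
    have ha : a = 0 := by nlinarith [sq_nonneg a, sq_nonneg b]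
    have hb : b = 0 := by nlinarith [sq_nonneg a, sq_nonneg b]
    exact h0 (by rw [← e, ha, hb]; ring)
  obtain ⟨l, hA, hB, hC⟩ : ∃ l, A = l * b ^ 2 ∧ B = -l * a * b ∧ C = l * a ^ 2 := by
    refine ⟨(A + C) / (a ^ 2 + b ^ 2), ?_, ?_, ?_⟩
    · field_simp
      linear_combination a * e0 - b * e1
    · field_simp
      linear_combination b * e0 + a * e1
    · field_simp
      linear_combination -a * e0 + b * e1
  have key : (dY 0 F q * dY 0 F q + F q * A) * (dY 1 F q * dY 1 F q + F q * C) -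
      (dY 0 F q * dY 1 F q + F q * B) * (dY 1 F q * dY 0 F q + F q * B) = F q ^ 3 * l := by
    rw [hA, hB, hC, ← e]; ring
  rw [key]
  fin_cases i <;> fin_cases j <;> simp [perp]
  · change F q ^ 3 * A = F q ^ 3 * l * (b * b); rw [hA]; ring
  · change F q ^ 3 * B = -(F q ^ 3 * l * (b * a)); rw [hB]; ring
  · change F q ^ 3 * dY 1 (dY 0 F) q = -(F q ^ 3 * l * (a * b)); rw [hs, hB]; ring
  · change F q ^ 3 * C = F q ^ 3 * l * (a * a); rw [hC]; ring

/-- `F` is a conic pseudo-Finsler metric on the conic open set `U`, of constant signature `ε`. -/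
structure IsFinsler (U : Set (Plane × Plane)) (ε : ℝ) (F : Plane × Plane → ℝ) : Prop where
  conic : IsConicOpen U
  homog : IsHomog U 1 F
  sign : ε = 1 ∨ ε = -1
  pos : ∀ q ∈ U, 0 < ε * detMetric F q

/-- The factor `μ = ε / √(ε 𝔤)` of `(m¹, m²) = μ (-ℓ₂, ℓ₁)`. -/
def mScale (ε : ℝ) (F : Plane × Plane → ℝ) (q : Plane × Plane) : ℝ := ε / √(ε * detMetric F q)

namespace IsFinsler

theorem sq_sign (h : IsFinsler U ε F) : ε ^ 2 = 1 := by
  rcases h.sign with h | h <;> simp [h]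

theorem sign_ne_zero (h : IsFinsler U ε F) : ε ≠ 0 := by
  rcases h.sign with h | h <;> simp [h]

theorem det_ne_zero (h : IsFinsler U ε F) (hq : q ∈ U) : detMetric F q ≠ 0 :=
  right_ne_zero_of_mul (h.pos q hq).ne'

theorem eps_eq (h : IsFinsler U ε F) (hq : q ∈ U) : eps F q = ε := by
  have hp := h.pos q hq
  rcases h.sign with rfl | rfl
  · exact Real.sign_of_pos (by linarith)
  · exact Real.sign_of_neg (by linarith)

/-- `gᵢⱼ` has rank at most one where `F` vanishes, so a metric has no zeros. -/
theorem ne_zero (h : IsFinsler U ε F) (hq : q ∈ U) : F q ≠ 0 := by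
  intro h0
  refine h.det_ne_zero hq ?_
  rw [detMetric, Matrix.det_fin_two]
  simp only [metric_apply h.conic h.homog hq, h0]
  ring

theorem mScale_sq (h : IsFinsler U ε F) (hq : q ∈ U) : mScale ε F q ^ 2 * detMetric F q = ε := by
  have hd := h.det_ne_zero hq
  rw [mScale, div_pow, Real.sq_sqrt (h.pos q hq).le]
  field_simp

theorem mScale_ne_zero (h : IsFinsler U ε F) (hq : q ∈ U) : mScale ε F q ≠ 0 := fun h0 =>
  h.sign_ne_zero (by rw [← h.mScale_sq hq, h0]; ring)

theorem mUp_zero (h : IsFinsler U ε F) (hq : q ∈ U) :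
    mUp F 0 q = -(mScale ε F q * dY 1 F q) := by
  simp [mUp, mScale, h.eps_eq hq, ellDown]

theorem mUp_one (h : IsFinsler U ε F) (hq : q ∈ U) :
    mUp F 1 q = mScale ε F q * dY 0 F q := by
  simp [mUp, mScale, h.eps_eq hq, ellDown]

theorem isHomog_mScale (h : IsFinsler U ε F) : IsHomog U 0 (mScale ε F) := by
  have h1 : IsHomog U 0 fun q => ε * detMetric F q :=
    (IsHomog.const ε).mul (isHomog_detMetric h.conic h.homog)
  exact (IsHomog.const ε).div (h1.sqrt fun q hq => (h.pos q hq).ne')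
    fun q hq => (Real.sqrt_pos.2 (h.pos q hq)).ne'

theorem isHomog_mUp (h : IsFinsler U ε F) (i : Fin 2) : IsHomog U 0 (mUp F i) := by
  have hd := fun i => (h.homog.dY h.conic i)
  fin_cases i
  · exact (h.isHomog_mScale.mul (hd 1)).neg.congr h.conic fun q hq => h.mUp_zero hq
  · exact (h.isHomog_mScale.mul (hd 0)).congr h.conic fun q hq => h.mUp_one hq

theorem v2_eq (h : IsFinsler U ε F) (hq : q ∈ U) (f : Plane × Plane → ℝ) :
    v2 F f q = ε * F q * (dY 0 f q * mUp F 0 q + dY 1 f q * mUp F 1 q) := by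
  rw [v2, h.eps_eq hq, Fin.sum_univ_two]

theorem isHomog_v2 (h : IsFinsler U ε F) (hf : IsHomog U r f) : IsHomog U r (v2 F f) := by
  have hm := h.isHomog_mUp
  have hd := hf.dY h.conic
  exact ((((IsHomog.const ε).mul h.homog).mul
    (((hd 0).mul (hm 0)).add ((hd 1).mul (hm 1)))).congr h.conic
      fun q hq => h.v2_eq hq f).congr_deg (by ring)

theorem isHomog_mainScalar (h : IsFinsler U ε F) : IsHomog U 0 (mainScalar F) := by
  have hm := h.isHomog_mUp
  have hC : ∀ i j k, IsHomog U (-1) (cartan F i j k) := fun i j k =>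
    ((IsHomog.const (1 / 2)).mul ((isHomog_metric h.conic h.homog i j).dY h.conic k)).congr_deg
      (by norm_num)
  have hs : IsHomog U (-1) fun q =>
      ∑ i, ∑ j, ∑ k, cartan F i j k q * mUp F i q * mUp F j q * mUp F k q :=
    .sum fun i _ => .sum fun j _ => .sum fun k _ => (((hC i j k).mul (hm i)).mul (hm j)).mul (hm k)
  refine ((((IsHomog.const ε).mul h.homog).mul hs).congr h.conic fun q hq => ?_).congr_deg
    (by norm_num)
  rw [mainScalar, h.eps_eq hq]

end IsFinsler

/-! ### The main scalar as a logarithmic derivative of the determinant -/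

theorem dY_metric_swap (hU : IsConicOpen U) (hF : IsHomog U 1 F) (hq : q ∈ U) (i j k : Fin 2) :
    dY k (fun p => metric F p i j) q = dY j (fun p => metric F p i k) q := by
  have h2 := hF.pow 2
  have key : ∀ i j k, dY k (fun p => metric F p i j) q =
      (1 / 2) * dY k (dY i (dY j fun p => F p ^ 2)) q := fun i j k => by
    have h := dY_mul hU (IsHomog.const (1 / 2)) ((h2.dY hU j).dY hU i) hq k
    rw [dY_const, zero_mul, zero_add] at h
    exact h
  rw [key, key, dY_eq_of_eqOn hU (fun p hp => dY_dY_comm hU h2 hp i j) hq k,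
    dY_dY_comm hU (h2.dY hU i) hq k j, dY_eq_of_eqOn hU (fun p hp => dY_dY_comm hU h2 hp i k) hq j]

theorem dY_metric_symm (hU : IsConicOpen U) (hF : IsHomog U 1 F) (hq : q ∈ U) (i j k : Fin 2) :
    dY k (fun p => metric F p i j) q = dY k (fun p => metric F p j i) q := by
  refine dY_eq_of_eqOn hU (fun p hp => ?_) hq k
  simp only [metric_apply hU hF hp]
  rw [dY_dY_comm hU hF hp i j]; ring

/-- Jacobi's formula: since `yⁱ ∂̇ₖ gᵢⱼ = 0`, only the `m`-components of `∂̇ₖ gᵢⱼ` contribute to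
`∂̇ₖ 𝔤`. -/
theorem dY_detMetric (hU : IsConicOpen U) (hF : IsHomog U 1 F) (hq : q ∈ U) (h0 : F q ≠ 0)
    (k : Fin 2) : dY k (detMetric F) q =
      dY k (fun p => metric F p 0 0) q * dY 1 F q ^ 2
        - 2 * dY k (fun p => metric F p 0 1) q * (dY 0 F q * dY 1 F q)
        + dY k (fun p => metric F p 1 1) q * dY 0 F q ^ 2 := by
  have hg := isHomog_metric hU hF
  have hd : dY k (detMetric F) q =
      (dY k (fun p => metric F p 0 0) q * metric F q 1 1 +
        metric F q 0 0 * dY k (fun p => metric F p 1 1) q) -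
      (dY k (fun p => metric F p 0 1) q * metric F q 1 0 +
        metric F q 0 1 * dY k (fun p => metric F p 1 0) q) := by
    rw [← dY_mul hU (hg 0 0) (hg 1 1) hq, ← dY_mul hU (hg 0 1) (hg 1 0) hq,
      dY_eq_of_eqOn hU (f := detMetric F) (g := fun p => metric F p 0 0 * metric F p 1 1 -
        metric F p 0 1 * metric F p 1 0) (fun p _ => Matrix.det_fin_two _) hq k]
    exact dY_sub hU ((hg 0 0).mul (hg 1 1)) ((hg 0 1).mul (hg 1 0)) hq k
  have e0 := euler_of_isHomog hU (hg 0 k) hq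
  have e1 := euler_of_isHomog hU (hg 1 k) hq
  rw [dY_metric_swap hU hF hq 0 k 0, dY_metric_swap hU hF hq 0 k 1] at e0
  rw [dY_metric_swap hU hF hq 1 k 0, dY_metric_swap hU hF hq 1 k 1,
    dY_metric_symm hU hF hq 1 0 k] at e1
  norm_num at e0 e1
  rw [dY_metric_symm hU hF hq 1 0 k] at hd
  have h00 := cube_mul_hessian hU hF hq h0 0 0
  have h01 := cube_mul_hessian hU hF hq h0 0 1
  have h11 := cube_mul_hessian hU hF hq h0 1 1
  have hs := dY_dY_comm hU hF hq 1 0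
  simp only [perp, Matrix.cons_val_zero, Matrix.cons_val_one] at h00 h01 h11
  simp only [metric_apply hU hF hq] at hd
  rw [hs] at hd
  refine mul_left_cancel₀ (pow_ne_zero 2 h0) ?_
  generalize dY k (fun p => metric F p 0 0) q = c0 at *
  generalize dY k (fun p => metric F p 0 1) q = c1 at *
  generalize dY k (fun p => metric F p 1 1) q = c2 at *
  rw [hd]
  linear_combination c0 * h11 + c2 * h00 - 2 * c1 * h01 +
    detMetric F q * (q.2 0 * e0 + q.2 1 * e1)

namespace IsFinsler

/-- In dimension two the mean Cartan tensor carries all of the Cartan tensor: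
`𝓘 = ½ F mᵏ ∂̇ₖ log |𝔤|`. -/
theorem mainScalar_mul_det (h : IsFinsler U ε F) (hq : q ∈ U) :
    mainScalar F q * detMetric F q =
      (1 / 2) * F q * (dY 0 (detMetric F) q * mUp F 0 q + dY 1 (detMetric F) q * mUp F 1 q) := by
  have hU := h.conic
  have hF := h.homog
  rw [dY_detMetric hU hF hq (h.ne_zero hq), dY_detMetric hU hF hq (h.ne_zero hq)]
  simp only [mainScalar, h.eps_eq hq, cartan, Fin.sum_univ_two]
  rw [dY_metric_symm hU hF hq 1 0 0, dY_metric_symm hU hF hq 1 0 1, h.mUp_zero hq, h.mUp_one hq]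
  have hμ := h.mScale_sq hq
  have hε := h.sq_sign
  generalize mScale ε F q = μ at *
  generalize detMetric F q = d at *
  generalize dY 0 F q = a at *
  generalize dY 1 F q = b at *
  generalize F q = F' at *
  linear_combination
    (1 / 2 * F' * μ * (-b * (dY 0 (fun p => metric F p 0 0) q * b ^ 2
        - 2 * dY 0 (fun p => metric F p 0 1) q * (a * b)
        + dY 0 (fun p => metric F p 1 1) q * a ^ 2) +
      a * (dY 1 (fun p => metric F p 0 0) q * b ^ 2
        - 2 * dY 1 (fun p => metric F p 0 1) q * (a * b)
        + dY 1 (fun p => metric F p 1 1) q * a ^ 2))) * (ε * hμ + hε)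

/-- The vertical Hessian of a function of degree `0` in the direction of `m`. -/
theorem v2_v2 (h : IsFinsler U ε F) (hφ : IsHomog U 0 φ) (hq : q ∈ U) :
    v2 F (v2 F φ) q = F q ^ 2 * (∑ i, ∑ j, dY i (dY j φ) q * mUp F i q * mUp F j q)
      - ε * mainScalar F q * v2 F φ q := by
  have hU := h.conic
  have hF := h.homog
  have h0 := h.ne_zero hq
  have hd0 := h.det_ne_zero hq
  have hμ0 := h.mScale_ne_zero hq
  have hε := h.sq_sign
  -- On `U` one has `φ_{;2} = μ (ε F (F_0 φ_1 - F_1 φ_0))`.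
  have hv : Set.EqOn (v2 F φ) (fun p => mScale ε F p * (F p * (ε * (dY 0 F p * dY 1 φ p -
      dY 1 F p * dY 0 φ p)))) U := fun p hp => by
    rw [h.v2_eq hp, h.mUp_zero hp, h.mUp_one hp]; ring
  have hA := (hF.dY hU 0).mul (hφ.dY hU 1)
  have hB := (hF.dY hU 1).mul (hφ.dY hU 0)
  have hS := hA.sub hB
  have hS' := (IsHomog.const (U := U) ε).mul hS
  have hdv : ∀ k, dY k (v2 F φ) q =
      dY k (mScale ε F) q * (F q * (ε * (dY 0 F q * dY 1 φ q - dY 1 F q * dY 0 φ q))) +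
      mScale ε F q * (dY k F q * (ε * (dY 0 F q * dY 1 φ q - dY 1 F q * dY 0 φ q)) +
        F q * (ε * (dY k (dY 0 F) q * dY 1 φ q + dY 0 F q * dY k (dY 1 φ) q -
          (dY k (dY 1 F) q * dY 0 φ q + dY 1 F q * dY k (dY 0 φ) q)))) := fun k => by
    rw [dY_eq_of_eqOn hU hv hq k, dY_mul hU h.isHomog_mScale (hF.mul hS') hq,
      dY_mul hU hF hS' hq, dY_mul hU (IsHomog.const ε) hS hq]
    rw [dY_sub hU hA hB hq, dY_mul hU (hF.dY hU 0) (hφ.dY hU 1) hq,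
      dY_mul hU (hF.dY hU 1) (hφ.dY hU 0) hq, dY_const]
    ring
  -- Differentiating `μ² 𝔤 = ε`.
  have hdμ : ∀ k, 2 * dY k (mScale ε F) q * detMetric F q =
      - (mScale ε F q * dY k (detMetric F) q) := fun k => by
    have e := dY_eq_of_eqOn hU (fun p hp => h.mScale_sq hp) hq k
    rw [dY_const, dY_mul hU (h.isHomog_mScale.pow 2) (isHomog_detMetric hU hF) hq,
      dY_sq hU h.isHomog_mScale hq] at e
    refine mul_left_cancel₀ hμ0 ?_
    linear_combination e
  have hI := h.mainScalar_mul_det hq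
  have hss := dY_dY_comm hU hF hq 1 0
  have h00 := cube_mul_hessian hU hF hq h0 0 0
  have h01 := cube_mul_hessian hU hF hq h0 0 1
  have h11 := cube_mul_hessian hU hF hq h0 1 1
  simp only [perp, Matrix.cons_val_zero, Matrix.cons_val_one] at h00 h01 h11
  have e := euler_of_isHomog hU hF hq
  have e' := euler_of_isHomog hU hφ hq
  norm_num at e e'
  rw [h.v2_eq hq, hdv, hdv, h.v2_eq hq φ, h.mUp_zero hq, h.mUp_one hq, hss]
  rw [h.mUp_zero hq, h.mUp_one hq] at hI
  simp only [Fin.sum_univ_two]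
  rw [h.mUp_zero hq, h.mUp_one hq]
  have k0 := hdμ 0
  have k1 := hdμ 1
  clear hdv hdμ hv hA hB hS hS' hφ
  generalize mScale ε F q = μ at *
  generalize dY 0 (mScale ε F) q = μ0 at *
  generalize dY 1 (mScale ε F) q = μ1 at *
  generalize dY 0 (detMetric F) q = d0 at *
  generalize dY 1 (detMetric F) q = d1 at *
  generalize detMetric F q = d at *
  generalize dY 0 (dY 0 F) q = A at *
  generalize dY 0 (dY 1 F) q = B at *
  generalize dY 1 (dY 1 F) q = C at *
  generalize dY 0 F q = a at *
  generalize dY 1 F q = b at *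
  generalize dY 0 φ q = u at *
  generalize dY 1 φ q = v at *
  generalize mainScalar F q = I at *
  generalize F q = F' at *
  generalize q.2 0 = x at *
  generalize q.2 1 = y at *
  -- The second derivatives of `F` drop out: `(∂̇ᵢ ∂̇ⱼ F) mʲ` is proportional to `n`, and so is the
  -- vertical gradient of `φ`.
  have hK : -b * (A * v - B * u) + a * (B * v - C * u) = 0 := by
    refine mul_left_cancel₀ (pow_ne_zero 3 h0) ?_
    linear_combination -b * (v * h00 - u * h01) + a * (v * h01 - u * h11)
      - d * (b * y + a * x) * e'
  have hμ0' : μ0 = -(μ * d0) / (2 * d) := by field_simp; linear_combination k0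
  have hμ1' : μ1 = -(μ * d1) / (2 * d) := by field_simp; linear_combination k1
  have hI' : I = 1 / 2 * F' * (d0 * -(μ * b) + d1 * (μ * a)) / d := by
    field_simp; linear_combination 2 * hI
  rw [hμ0', hμ1', hI']
  linear_combination ε ^ 2 * μ ^ 2 * F' ^ 2 * hK + F' ^ 2 * μ ^ 2 *
    (dY 0 (dY 0 φ) q * b ^ 2 - (dY 0 (dY 1 φ) q + dY 1 (dY 0 φ) q) * (a * b)
      + dY 1 (dY 1 φ) q * a ^ 2) * hε

end IsFinsler

/-! ### The determinant and the main scalar of the changed metric -/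

theorem isHomog_exp_mul (hF : IsHomog U 1 F) (hφ : IsHomog U 0 φ) :
    IsHomog U 1 fun q => Real.exp (φ q) * F q :=
  (hφ.exp.mul hF).congr_deg (by norm_num)

theorem fderiv_exp_mul (hU : IsConicOpen U) (hF : IsHomog U r F) (hφ : IsHomog U 0 φ) (hq : q ∈ U)
    (v : Plane × Plane) : fderiv ℝ (fun p => Real.exp (φ p) * F p) q v =
      Real.exp (φ q) * (fderiv ℝ φ q v * F q + fderiv ℝ F q v) := by
  rw [fderiv_mul_apply hU hφ.exp hF hq, fderiv_exp (hφ.differentiableAt hU hq)]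
  simp only [smul_apply, smul_eq_mul]
  ring

theorem dY_exp_mul (hU : IsConicOpen U) (hF : IsHomog U r F) (hφ : IsHomog U 0 φ) (hq : q ∈ U)
    (i : Fin 2) : dY i (fun p => Real.exp (φ p) * F p) q =
      Real.exp (φ q) * (dY i φ q * F q + dY i F q) :=
  fderiv_exp_mul hU hF hφ hq _

theorem isHomog_dY_mul_add_dY (hU : IsConicOpen U) (hF : IsHomog U 1 F) (hφ : IsHomog U 0 φ)
    (i : Fin 2) : IsHomog U 0 fun q => dY i φ q * F q + dY i F q :=
  (((hφ.dY hU i).mul hF).congr_deg (by norm_num)).add ((hF.dY hU i).congr_deg (by norm_num))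

/-- The derivative of `∂̇ᵢ F̄` in an arbitrary direction of the `(x, y)`-plane. -/
theorem fderiv_dY_exp_mul (hU : IsConicOpen U) (hF : IsHomog U 1 F) (hφ : IsHomog U 0 φ)
    (hq : q ∈ U) (i : Fin 2) (v : Plane × Plane) :
    fderiv ℝ (dY i fun p => Real.exp (φ p) * F p) q v =
      Real.exp (φ q) * (fderiv ℝ φ q v * (dY i φ q * F q + dY i F q) +
        (fderiv ℝ (dY i φ) q v * F q + dY i φ q * fderiv ℝ F q v + fderiv ℝ (dY i F) q v)) := by
  have h1 := (hφ.dY hU i).mul hF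
  rw [fderiv_eq_of_eqOn hU (fun p hp => dY_exp_mul hU hF hφ hp i) hq,
    fderiv_exp_mul hU (isHomog_dY_mul_add_dY hU hF hφ i) hφ hq,
    fderiv_fun_add (h1.differentiableAt hU hq) ((hF.dY hU i).differentiableAt hU hq), add_apply,
    fderiv_mul_apply hU (hφ.dY hU i) hF hq]

theorem dY_mul_dY_comm (hU : IsConicOpen U) (hf : IsHomog U 0 f) (hg : IsHomog U 0 g) (hq : q ∈ U)
    (hy : q.2 ≠ 0) : dY 0 f q * dY 1 g q = dY 1 f q * dY 0 g q := by
  have ef := euler_of_isHomog hU hf hq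
  have eg := euler_of_isHomog hU hg hq
  norm_num at ef eg
  by_cases h0 : q.2 0 = 0
  · have h1 : q.2 1 ≠ 0 := fun h1 => hy (by ext i; fin_cases i <;> simp [h0, h1])
    refine mul_left_cancel₀ h1 ?_
    linear_combination dY 0 f q * eg - dY 0 g q * ef
  · refine mul_left_cancel₀ h0 ?_
    linear_combination dY 1 g q * ef - dY 1 f q * eg

namespace IsFinsler

theorem snd_ne_zero (h : IsFinsler U ε F) (hq : q ∈ U) : q.2 ≠ 0 := fun h0 => by
  have e := euler_of_isHomog h.conic h.homog hq
  rw [h0] at e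
  norm_num at e
  exact h.ne_zero hq e.symm

theorem perp_mul_mUp (h : IsFinsler U ε F) (hq : q ∈ U) :
    perp q 0 * mUp F 0 q + perp q 1 * mUp F 1 q = mScale ε F q * F q := by
  have e := euler_of_isHomog h.conic h.homog hq
  norm_num at e
  rw [h.mUp_zero hq, h.mUp_one hq]
  simp only [perp, Matrix.cons_val_zero, Matrix.cons_val_one]
  linear_combination mScale ε F q * e

/-- The definition of `ρ` through scalar derivatives agrees with the regularity expression of the
change. -/
theorem inv_rho (h : IsFinsler U ε F) (hφ : IsHomog U 0 φ) (hq : q ∈ U) :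
    (rho F φ q)⁻¹ = changeDiscriminant F φ q := by
  rw [rho, one_div, inv_inv, sigma, changeDiscriminant, h.eps_eq hq, h.v2_v2 hφ hq, h.v2_eq hq]
  simp only [Fin.sum_univ_two]
  linear_combination F q ^ 2 * (dY 0 φ q * mUp F 0 q + dY 1 φ q * mUp F 1 q) ^ 2 * h.sq_sign

/-- Contract the Hessians of `F̄ = e^φ F` and `F` twice with `m`. -/
theorem detMetric_exp_mul (h : IsFinsler U ε F) (hφ : IsHomog U 0 φ) (hq : q ∈ U) :
    detMetric (fun p => Real.exp (φ p) * F p) q =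
      ε * (rho F φ q)⁻¹ * Real.exp (φ q) ^ 4 * detMetric F q := by
  have hU := h.conic
  have hF := h.homog
  have h0 := h.ne_zero hq
  have hE := Real.exp_ne_zero (φ q)
  have hb := cube_mul_hessian hU (isHomog_exp_mul hF hφ) hq (mul_ne_zero hE h0)
  have hc := cube_mul_hessian hU hF hq h0
  have hd : ∀ i j, dY i (dY j fun p => Real.exp (φ p) * F p) q = Real.exp (φ q) *
      (dY i φ q * (dY j φ q * F q + dY j F q) +
        (dY i (dY j φ) q * F q + dY j φ q * dY i F q + dY i (dY j F) q)) :=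
    fun i j => fderiv_dY_exp_mul hU hF hφ hq j _
  simp only [hd] at hb
  have hn := h.perp_mul_mUp hq
  have hμ := h.mScale_sq hq
  have hμ0 := h.mScale_ne_zero hq
  have hε := h.sq_sign
  have hm : dY 0 F q * mUp F 0 q + dY 1 F q * mUp F 1 q = 0 := by
    rw [h.mUp_zero hq, h.mUp_one hq]; ring
  rw [h.inv_rho hφ hq, changeDiscriminant, h.eps_eq hq]
  simp only [Fin.sum_univ_two]
  have b00 := hb 0 0
  have b01 := hb 0 1
  have b10 := hb 1 0
  have b11 := hb 1 1
  have c00 := hc 0 0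
  have c01 := hc 0 1
  have c10 := hc 1 0
  have c11 := hc 1 1
  clear hb hc hd
  generalize detMetric (fun p => Real.exp (φ p) * F p) q = d' at *
  generalize detMetric F q = d at *
  generalize Real.exp (φ q) = E at *
  generalize mScale ε F q = μ at *
  generalize dY 0 (dY 0 F) q = A at *
  generalize dY 0 (dY 1 F) q = B at *
  generalize dY 1 (dY 0 F) q = B' at *
  generalize dY 1 (dY 1 F) q = C at *
  generalize dY 0 F q = a at *
  generalize dY 1 F q = b at *
  generalize dY 0 φ q = u at *
  generalize dY 1 φ q = v at *
  generalize mUp F 0 q = m at *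
  generalize mUp F 1 q = n at *
  generalize F q = F' at *
  generalize perp q 0 = x at *
  generalize perp q 1 = y at *
  have hA : F' ^ 3 * (A * m * m + B * m * n + B' * n * m + C * n * n) = d * (μ * F') ^ 2 := by
    rw [← hn]
    linear_combination m * m * c00 + m * n * c01 + n * m * c10 + n * n * c11
  refine mul_left_cancel₀ (mul_ne_zero (pow_ne_zero 2 hμ0) (pow_ne_zero 2 h0)) ?_
  have key : d' * (μ * F') ^ 2 = E ^ 4 * (F' ^ 3 * ((A * m * m + B * m * n + B' * n * m + C * n * n)
      + F' * ((dY 0 (dY 0 φ) q + u * u) * m * m + (dY 0 (dY 1 φ) q + u * v) * m * n +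
        ((dY 1 (dY 0 φ) q + v * u) * n * m + (dY 1 (dY 1 φ) q + v * v) * n * n)))) := by
    rw [← hn]
    linear_combination -(m * m * b00 + m * n * b01 + n * m * b10 + n * n * b11)
      + (E * F') ^ 3 * E * 2 * (u * m + v * n) * hm
  generalize (dY 0 (dY 0 φ) q + u * u) * m * m + (dY 0 (dY 1 φ) q + u * v) * m * n +
        ((dY 1 (dY 0 φ) q + v * u) * n * m + (dY 1 (dY 1 φ) q + v * v) * n * n) = T at *
  linear_combination key + E ^ 4 * hA - E ^ 4 * F' ^ 4 * T * hε
    - E ^ 4 * F' ^ 4 * T * ε * hμ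
    - E ^ 4 * F' ^ 2 * μ ^ 2 * d * hε

theorem inv_rho_pos (h : IsFinsler U ε F) (hφ : IsHomog U 0 φ)
    (h' : IsFinsler U ε fun p => Real.exp (φ p) * F p) (hq : q ∈ U) :
    0 < ε * (rho F φ q)⁻¹ := by
  have hpos := h.pos q hq
  have hpos' := h'.pos q hq
  rw [h.detMetric_exp_mul hφ hq] at hpos'
  have h1 : 0 < (ε * (rho F φ q)⁻¹) * (Real.exp (φ q) ^ 4 * (ε * detMetric F q)) := by
    convert hpos' using 1; ring
  exact pos_of_mul_pos_left h1 (by positivity)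

/-- On functions of degree `0` the vertical derivatives of `F̄` and `F` are proportional. -/
theorem v2_exp_mul (h : IsFinsler U ε F) (hφ : IsHomog U 0 φ)
    (h' : IsFinsler U ε fun p => Real.exp (φ p) * F p) (hf : IsHomog U 0 f) (hq : q ∈ U) :
    v2 (fun p => Real.exp (φ p) * F p) f q = √(ε * rho F φ q) * v2 F f q := by
  have hU := h.conic
  have hcomm := dY_mul_dY_comm hU hf hφ hq (h.snd_ne_zero hq)
  have hpos := h.pos q hq
  have hd := h.detMetric_exp_mul hφ hq
  have hinv := h.inv_rho_pos hφ h' hq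
  have hρ : ε * rho F φ q = (ε * (rho F φ q)⁻¹)⁻¹ := by
    rcases h.sign with rfl | rfl <;> simp
  have hμ : mScale ε (fun p => Real.exp (φ p) * F p) q * Real.exp (φ q) ^ 2 =
      √(ε * rho F φ q) * mScale ε F q := by
    have h2 : ε * detMetric (fun p => Real.exp (φ p) * F p) q =
        (Real.exp (φ q) ^ 2) ^ 2 * ((ε * (rho F φ q)⁻¹) * (ε * detMetric F q)) := by
      rw [hd]; ring
    rw [hρ, Real.sqrt_inv, mScale, mScale, h2, Real.sqrt_mul (by positivity),
      Real.sqrt_sq (by positivity), Real.sqrt_mul hinv.le]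
    have := (Real.sqrt_pos.2 hinv).ne'
    have := (Real.sqrt_pos.2 hpos).ne'
    field_simp
  rw [h.v2_eq hq, h'.v2_eq hq, h.mUp_zero hq, h.mUp_one hq, h'.mUp_zero hq, h'.mUp_one hq,
    dY_exp_mul hU h.homog hφ hq, dY_exp_mul hU h.homog hφ hq]
  linear_combination ε * F q * (dY 1 f q * dY 0 F q - dY 0 f q * dY 1 F q) * hμ -
    ε * Real.exp (φ q) ^ 2 * F q ^ 2 *
      mScale ε (fun p => Real.exp (φ p) * F p) q * hcomm

theorem rho_ne_zero (h : IsFinsler U ε F) (hφ : IsHomog U 0 φ)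
    (h' : IsFinsler U ε fun p => Real.exp (φ p) * F p) (hq : q ∈ U) : rho F φ q ≠ 0 := fun h0 => by
  simpa [h0] using h.inv_rho_pos hφ h' hq

theorem sign_mul_rho_pos (h : IsFinsler U ε F) (hφ : IsHomog U 0 φ)
    (h' : IsFinsler U ε fun p => Real.exp (φ p) * F p) (hq : q ∈ U) : 0 < ε * rho F φ q := by
  have h1 := inv_pos.2 (h.inv_rho_pos hφ h' hq)
  rcases h.sign with rfl | rfl <;> simpa using h1

theorem isHomog_rho (h : IsFinsler U ε F) (hφ : IsHomog U 0 φ)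
    (h' : IsFinsler U ε fun p => Real.exp (φ p) * F p) : IsHomog U 0 (rho F φ) := by
  have hv := h.isHomog_v2 hφ
  have hσ : IsHomog U 0 fun q =>
      v2 F (v2 F φ) q + ε * mainScalar F q * v2 F φ q + v2 F φ q ^ 2 + ε :=
    (((h.isHomog_v2 hv).add (((IsHomog.const ε).mul h.isHomog_mainScalar).mul hv)).add
      (hv.pow 2)).add (IsHomog.const ε)
  have heq : ∀ q ∈ U, (rho F φ q)⁻¹ =
      v2 F (v2 F φ) q + ε * mainScalar F q * v2 F φ q + v2 F φ q ^ 2 + ε := fun q hq => by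
    rw [rho, one_div, inv_inv, sigma, h.eps_eq hq]; ring
  refine (hσ.inv fun q hq => ?_).congr h.conic fun q hq => ?_
  · rw [← heq q hq]
    exact inv_ne_zero (h.rho_ne_zero hφ h' hq)
  · rw [← heq q hq, inv_inv]

theorem v2_eq_fderiv (h : IsFinsler U ε F) (hq : q ∈ U) (f : Plane × Plane → ℝ) :
    v2 F f q = fderiv ℝ f q (0, (ε * F q) • !₂[mUp F 0 q, mUp F 1 q]) := by
  rw [fderiv_eq_sum, h.v2_eq hq]
  simp
  ring

/-- Since `𝓘 = ½ ε (log |𝔤|)_{;2}` for every metric, the formula for `𝔤̄` gives that of `𝓘̄`. -/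
theorem mainScalar_exp_mul (h : IsFinsler U ε F) (hφ : IsHomog U 0 φ)
    (h' : IsFinsler U ε fun p => Real.exp (φ p) * F p) (hq : q ∈ U) :
    mainScalar (fun p => Real.exp (φ p) * F p) q =
      √(ε * rho F φ q) * (mainScalar F q + 2 * ε * v2 F φ q -
        ε * v2 F (rho F φ) q / (2 * rho F φ q)) := by
  have hU := h.conic
  have hd := isHomog_detMetric hU h.homog
  have hd' := isHomog_detMetric hU h'.homog
  have hr := h.isHomog_rho hφ h'
  have hr0 := h.rho_ne_zero hφ h' hq
  have hε := h.sq_sign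
  have h4 : IsHomog U 0 fun q => 4 * φ q := (IsHomog.const 4).mul hφ
  have hI := h.mainScalar_mul_det hq
  have hI' := h'.mainScalar_mul_det hq
  have hd0' := h'.det_ne_zero hq
  have hdet : Set.EqOn (fun p => detMetric (fun p => Real.exp (φ p) * F p) p * rho F φ p)
      (fun p => ε * (Real.exp (4 * φ p) * detMetric F p)) U := fun p hp => by
    have := h.rho_ne_zero hφ h' hp
    simp only
    rw [h.detMetric_exp_mul hφ hp, mul_comm 4, Real.exp_mul]
    norm_cast
    field_simp
  have hv := h.v2_exp_mul hφ h' hd' hq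
  -- the logarithmic derivative of the formula for the determinant
  have hlog : v2 F (detMetric fun p => Real.exp (φ p) * F p) q * rho F φ q +
      detMetric (fun p => Real.exp (φ p) * F p) q * v2 F (rho F φ) q =
      ε * (Real.exp (4 * φ q) * (4 * v2 F φ q * detMetric F q + v2 F (detMetric F) q)) := by
    simp only [h.v2_eq_fderiv hq]
    rw [← fderiv_mul_apply hU hd' hr hq, fderiv_eq_of_eqOn hU hdet hq,
      fderiv_mul_apply hU (IsHomog.const ε) (h4.exp.mul hd) hq, fderiv_exp_mul hU hd h4 hq,
      fderiv_mul_apply hU (IsHomog.const 4) hφ hq]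
    simp
  have hdq := hdet hq
  simp only at hdq
  have e1 := h.v2_eq hq (detMetric F)
  have e2 := h'.v2_eq hq (detMetric fun p => Real.exp (φ p) * F p)
  have hI1 : mainScalar F q * detMetric F q = 1 / 2 * ε * v2 F (detMetric F) q := by
    rw [hI, e1]; linear_combination -(1 / 2) * F q * (dY 0 (detMetric F) q * mUp F 0 q +
      dY 1 (detMetric F) q * mUp F 1 q) * hε
  have hI2 : mainScalar (fun p => Real.exp (φ p) * F p) q *
      detMetric (fun p => Real.exp (φ p) * F p) q =
      1 / 2 * ε * (√(ε * rho F φ q) * v2 F (detMetric fun p => Real.exp (φ p) * F p) q) := by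
    rw [← hv, hI', e2]
    linear_combination -(1 / 2) * (Real.exp (φ q) * F q) *
      (dY 0 (detMetric fun p => Real.exp (φ p) * F p) q * mUp (fun p => Real.exp (φ p) * F p) 0 q +
      dY 1 (detMetric fun p => Real.exp (φ p) * F p) q *
        mUp (fun p => Real.exp (φ p) * F p) 1 q) * hε
  refine mul_right_cancel₀ (mul_ne_zero hd0' hr0) ?_
  rw [← mul_assoc, hI2]
  field_simp
  linear_combination ε * √(ε * rho F φ q) * hlog
    + (-2 * mainScalar F q - 4 * ε * v2 F φ q) * √(ε * rho F φ q) * hdq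
    - 2 * ε * Real.exp (4 * φ q) * √(ε * rho F φ q) * hI1

end IsFinsler

/-! ### The geodesic spray -/

/-- The geodesic spray as a vector field on the `(x, y)`-space. -/
def sprayVec (F : Plane × Plane → ℝ) (q : Plane × Plane) : Plane × Plane :=
  (q.2, (-2 : ℝ) • !₂[sprayCoeff F 0 q, sprayCoeff F 1 q])

theorem spray_eq (F f : Plane × Plane → ℝ) (q : Plane × Plane) :
    spray F f q = q.2 0 * dX 0 f q + q.2 1 * dX 1 f q -
      2 * (sprayCoeff F 0 q * dY 0 f q + sprayCoeff F 1 q * dY 1 f q) := by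
  simp only [spray, Fin.sum_univ_two]

theorem spray_eq_fderiv (F f : Plane × Plane → ℝ) (q : Plane × Plane) :
    spray F f q = fderiv ℝ f q (sprayVec F q) := by
  rw [fderiv_eq_sum, spray_eq]
  simp [sprayVec]
  ring

theorem dY_coord (i k : Fin 2) (q : Plane × Plane) :
    dY k (fun p => p.2 i) q = if i = k then 1 else 0 := by
  have hd : HasFDerivAt (fun p : Plane × Plane => p.2 i)
      ((EuclideanSpace.proj i : Plane →L[ℝ] ℝ).comp (ContinuousLinearMap.snd ℝ Plane Plane)) q :=
    ((EuclideanSpace.proj i : Plane →L[ℝ] ℝ).comp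
      (ContinuousLinearMap.snd ℝ Plane Plane)).hasFDerivAt
  rw [dY, hd.fderiv]
  simp

namespace IsFinsler

theorem isHomog_sprayCoeff (h : IsFinsler U ε F) (i : Fin 2) : IsHomog U 2 (sprayCoeff F i) := by
  have hU := h.conic
  have hg := isHomog_metric hU h.homog
  have hL := h.homog.pow 2
  have hdet := isHomog_detMetric hU h.homog
  have hY : ∀ k, IsHomog U 2 fun q => (∑ r, q.2 r * dX r (dY k fun p => F p ^ 2) q) -
      dX k (fun p => F p ^ 2) q := fun k =>
    (IsHomog.sum fun r _ => ((IsHomog.coord r).mul ((hL.dY hU k).dX hU r)).congr_deg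
      (by norm_num)).sub ((hL.dX hU k).congr_deg (by norm_num))
  have hinv : ∀ i j, IsHomog U 0 fun q => (metric F q)⁻¹ i j := fun i j => by
    have hadj : IsHomog U 0 fun q => (metric F q).adjugate i j := by
      fin_cases i <;> fin_cases j <;> simp only [Matrix.adjugate_fin_two]
      exacts [hg 1 1, (hg 0 1).neg, (hg 1 0).neg, hg 0 0]
    refine ((hdet.inv fun q hq => h.det_ne_zero hq).mul hadj).congr hU fun q _ => ?_
    rw [Matrix.inv_def, Ring.inverse_eq_inv']
    rfl
  exact ((IsHomog.const (1 / 4)).mul (IsHomog.sum fun k _ => (hinv i k).mul (hY k))).congr_deg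
    (by norm_num)

/-- The Euler–Lagrange equations of the energy `F²`. -/
theorem metric_mul_sprayCoeff (h : IsFinsler U ε F) (hq : q ∈ U) (i : Fin 2) :
    4 * (metric F q i 0 * sprayCoeff F 0 q + metric F q i 1 * sprayCoeff F 1 q) =
      (q.2 0 * dX 0 (dY i fun p => F p ^ 2) q + q.2 1 * dX 1 (dY i fun p => F p ^ 2) q) -
        dX i (fun p => F p ^ 2) q := by
  set Y : Fin 2 → ℝ := fun k => (∑ r, q.2 r * dX r (dY k fun p => F p ^ 2) q) -
      dX k (fun p => F p ^ 2) q with hY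
  have hG : (fun j => sprayCoeff F j q) = (1 / 4 : ℝ) • ((metric F q)⁻¹.mulVec Y) := by
    ext j
    simp only [sprayCoeff, Pi.smul_apply, Matrix.mulVec, dotProduct, smul_eq_mul, hY]
  have hunit : IsUnit (metric F q).det := (h.det_ne_zero hq).isUnit
  have hmul : (metric F q).mulVec (fun j => sprayCoeff F j q) = (1 / 4 : ℝ) • Y := by
    rw [hG, Matrix.mulVec_smul, Matrix.mulVec_mulVec, Matrix.mul_nonsing_inv _ hunit,
      Matrix.one_mulVec]
  have hi := congrFun hmul i
  simp only [Matrix.mulVec, dotProduct, Fin.sum_univ_two, Pi.smul_apply, smul_eq_mul, hY] at hi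
  linear_combination 4 * hi

theorem dY_mul_spray_add (h : IsFinsler U ε F) (hq : q ∈ U) (i : Fin 2) :
    dY i F q * spray F F q + F q * (spray F (dY i F) q - dX i F q) = 0 := by
  have hU := h.conic
  have hF := h.homog
  have hm := h.metric_mul_sprayCoeff hq i
  rw [metric_apply hU hF hq, metric_apply hU hF hq, dX_dY_sq hU hF hq, dX_dY_sq hU hF hq,
    dX_sq hU hF hq, dY_dY_comm hU hF hq i 0, dY_dY_comm hU hF hq i 1] at hm
  rw [spray_eq, spray_eq]
  linear_combination -(1 / 2) * hm

/-- `F` is constant along its geodesics: contract the Euler–Lagrange equations with `y`. -/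
theorem spray_self (h : IsFinsler U ε F) (hq : q ∈ U) : spray F F q = 0 := by
  have hU := h.conic
  have hF := h.homog
  have k0 := h.dY_mul_spray_add hq 0
  have k1 := h.dY_mul_spray_add hq 1
  have e := euler_of_isHomog hU hF hq
  have e0 := euler_of_isHomog hU (hF.dY hU 0) hq
  have e1 := euler_of_isHomog hU (hF.dY hU 1) hq
  have x0 := euler_of_isHomog hU (hF.dX hU 0) hq
  have x1 := euler_of_isHomog hU (hF.dX hU 1) hq
  simp only [← dX_dY_comm hU hF hq] at x0 x1
  norm_num at e e0 e1 x0 x1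
  refine (mul_eq_zero.1 ?_).resolve_left (h.ne_zero hq)
  rw [spray_eq F (dY 0 F)] at k0
  rw [spray_eq F (dY 1 F)] at k1
  have hs := dY_dY_comm hU hF hq 1 0
  rw [hs] at k0 e0
  linear_combination q.2 0 * k0 + q.2 1 * k1 - spray F F q * e - F q * (q.2 0 * x0 + q.2 1 * x1
    - 2 * (sprayCoeff F 0 q * e0 + sprayCoeff F 1 q * e1))

/-- The Euler–Lagrange equations of `F`. -/
theorem spray_dY (h : IsFinsler U ε F) (hq : q ∈ U) (i : Fin 2) :
    spray F (dY i F) q = dX i F q := by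
  have k := h.dY_mul_spray_add hq i
  rwa [h.spray_self hq, mul_zero, zero_add, mul_eq_zero, or_iff_right (h.ne_zero hq),
    sub_eq_zero] at k

/-- The horizontal derivative `f_{,1}` is the spray derivative divided by `F`, because `Gʲ` has
degree `2`. -/
theorem mul_h1 (h : IsFinsler U ε F) (hq : q ∈ U) (f : Plane × Plane → ℝ) :
    F q * h1 F f q = spray F f q := by
  have e0 := euler_of_isHomog h.conic (h.isHomog_sprayCoeff 0) hq
  have e1 := euler_of_isHomog h.conic (h.isHomog_sprayCoeff 1) hq
  have h0 := h.ne_zero hq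
  norm_num at e0 e1
  rw [spray_eq]
  simp only [h1, delta, ellUp, Fin.sum_univ_two]
  field_simp
  linear_combination -dY 0 f q * e0 - dY 1 f q * e1

theorem isHomog_spray (h : IsFinsler U ε F) (hf : IsHomog U 0 f) : IsHomog U 1 (spray F f) := by
  have hU := h.conic
  have hG := h.isHomog_sprayCoeff
  have hx := hf.dX hU
  have hy := hf.dY hU
  refine IsHomog.congr (f := fun q => q.2 0 * dX 0 f q + q.2 1 * dX 1 f q -
      2 * (sprayCoeff F 0 q * dY 0 f q + sprayCoeff F 1 q * dY 1 f q)) hU ?_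
    fun q _ => spray_eq F f q
  have a := (((IsHomog.coord 0).mul (hx 0)).add ((IsHomog.coord 1).mul (hx 1))).congr_deg
    (s := 1) (by norm_num)
  have b := ((IsHomog.const 2).mul (((hG 0).mul (hy 0)).add ((hG 1).mul (hy 1)))).congr_deg
    (s := 1) (by norm_num)
  exact a.sub b

/-- The commutator of `∂̇ₖ` and the spray is `δₖ - (∂̇ₖ Gʲ) ∂̇ⱼ`. -/
theorem dY_spray (h : IsFinsler U ε F) (hf : IsHomog U 0 f) (hq : q ∈ U) (k : Fin 2) :
    dY k (spray F f) q = dX k f q + spray F (dY k f) q -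
      2 * (dY k (sprayCoeff F 0) q * dY 0 f q + dY k (sprayCoeff F 1) q * dY 1 f q) := by
  have hU := h.conic
  have hG := h.isHomog_sprayCoeff
  have hx := hf.dX hU
  have hy := hf.dY hU
  have c := fun i => IsHomog.coord (U := U) i
  have hc := fun i => (c i).mul (hx i)
  have hg := fun i => (hG i).mul (hy i)
  have hd : dY k (spray F f) q = (dY k (fun p => p.2 0 * dX 0 f p) q +
      dY k (fun p => p.2 1 * dX 1 f p) q) - 2 * (dY k (fun p => sprayCoeff F 0 p * dY 0 f p) q +
      dY k (fun p => sprayCoeff F 1 p * dY 1 f p) q) := by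
    rw [dY_eq_of_eqOn hU (fun p _ => spray_eq F f p) hq k]
    rw [dY_sub hU ((hc 0).add (hc 1)) ((IsHomog.const 2).mul ((hg 0).add (hg 1))) hq,
      dY_mul hU (IsHomog.const 2) ((hg 0).add (hg 1)) hq, dY_add hU (hc 0) (hc 1) hq,
      dY_add hU (hg 0) (hg 1) hq, dY_const, zero_mul, zero_add]
  rw [hd, dY_mul hU (c 0) (hx 0) hq, dY_mul hU (c 1) (hx 1) hq, dY_mul hU (hG 0) (hy 0) hq,
    dY_mul hU (hG 1) (hy 1) hq, spray_eq, dX_dY_comm hU hf hq, dX_dY_comm hU hf hq,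
    dY_coord, dY_coord, dY_dY_comm hU hf hq 0 k, dY_dY_comm hU hf hq 1 k]
  fin_cases k <;> simp <;> ring

/-- The covariant expression defining `Q` unfolds to the one that arises from the Euler–Lagrange
equations of `F̄ = e^φ F`. -/
theorem two_mul_Q (h : IsFinsler U ε F) (hφ : IsHomog U 0 φ) (hq : q ∈ U) :
    2 * Q F φ q = rho F φ q * F q ^ 2 *
      (spray F φ q * (dY 0 φ q * mUp F 0 q + dY 1 φ q * mUp F 1 q) +
        ((spray F (dY 0 φ) q - dX 0 φ q) * mUp F 0 q +
          (spray F (dY 1 φ) q - dX 1 φ q) * mUp F 1 q)) := by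
  have hU := h.conic
  have hF := h.homog
  have hε := h.sq_sign
  have hh1 : IsHomog U 0 (h1 F φ) :=
    (((h.isHomog_spray hφ).div hF fun q hq => h.ne_zero hq).congr hU fun q hq => by
      rw [← h.mul_h1 hq, mul_div_cancel_left₀ _ (h.ne_zero hq)]).congr_deg (by norm_num)
  have hs : ∀ k, dY k (spray F φ) q = dY k F q * h1 F φ q + F q * dY k (h1 F φ) q := fun k => by
    rw [← dY_mul hU hF hh1 hq]
    exact dY_eq_of_eqOn hU (fun p hp => (h.mul_h1 hp φ).symm) hq k
  have s0 := hs 0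
  have s1 := hs 1
  rw [h.dY_spray hφ hq] at s0 s1
  have hm : dY 0 F q * mUp F 0 q + dY 1 F q * mUp F 1 q = 0 := by
    rw [h.mUp_zero hq, h.mUp_one hq]; ring
  have hh := h.mul_h1 hq φ
  rw [Q, h.eps_eq hq, h.v2_eq hq φ, h.v2_eq hq (h1 F φ), h2, h.eps_eq hq]
  simp only [delta, Fin.sum_univ_two]
  generalize h1 F φ q = η at *
  generalize dY 0 (h1 F φ) q = η0 at *
  generalize dY 1 (h1 F φ) q = η1 at *
  linear_combination
    ε ^ 2 * rho F φ q * F q ^ 2 * (dY 0 φ q * mUp F 0 q + dY 1 φ q * mUp F 1 q) * hh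
    - ε ^ 2 * rho F φ q * F q ^ 2 * (mUp F 0 q * s0 + mUp F 1 q * s1)
    - ε ^ 2 * rho F φ q * F q ^ 2 * η * hm
    + rho F φ q * F q ^ 2 * (spray F φ q * (dY 0 φ q * mUp F 0 q + dY 1 φ q * mUp F 1 q) +
        ((spray F (dY 0 φ) q - dX 0 φ q) * mUp F 0 q +
          (spray F (dY 1 φ) q - dX 1 φ q) * mUp F 1 q)) * hε

/-- The difference of the two sprays is `Q m` up to a multiple of `y`. -/
theorem perp_mul_sprayCoeff_sub (h : IsFinsler U ε F) (hφ : IsHomog U 0 φ)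
    (h' : IsFinsler U ε fun p => Real.exp (φ p) * F p) (hq : q ∈ U) :
    perp q 0 * (sprayCoeff (fun p => Real.exp (φ p) * F p) 0 q - sprayCoeff F 0 q) +
      perp q 1 * (sprayCoeff (fun p => Real.exp (φ p) * F p) 1 q - sprayCoeff F 1 q) =
    Q F φ q * (mScale ε F q * F q) := by
  have hU := h.conic
  have hF := h.homog
  have h0 := h.ne_zero hq
  have hμ := h.mScale_sq hq
  have hr0 := h.rho_ne_zero hφ h' hq
  have hε := h.sq_sign
  have hn := h.perp_mul_mUp hq
  have hQ := h.two_mul_Q hφ hq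
  have hm : dY 0 F q * mUp F 0 q + dY 1 F q * mUp F 1 q = 0 := by
    rw [h.mUp_zero hq, h.mUp_one hq]; ring
  -- the Euler–Lagrange equations of `F̄`, with its spray expressed by the spray of `F`
  have key : ∀ i, 2 * (Real.exp (φ q) * F q) ^ 3 *
      ((sprayCoeff (fun p => Real.exp (φ p) * F p) 0 q - sprayCoeff F 0 q) *
        dY 0 (dY i fun p => Real.exp (φ p) * F p) q +
      (sprayCoeff (fun p => Real.exp (φ p) * F p) 1 q - sprayCoeff F 1 q) *
        dY 1 (dY i fun p => Real.exp (φ p) * F p) q) =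
      (Real.exp (φ q) * F q) ^ 3 * (Real.exp (φ q) * (spray F φ q * (dY i φ q * F q + dY i F q) +
        (spray F (dY i φ) q * F q + dY i φ q * spray F F q) - dX i φ q * F q)) := fun i => by
    have e1 := h'.spray_dY hq i
    have e2 := h.spray_dY hq i
    have e3 : dX i (fun p => Real.exp (φ p) * F p) q =
      Real.exp (φ q) * (dX i φ q * F q + dX i F q) := fderiv_exp_mul hU hF hφ hq _
    have e4 : spray F (dY i fun p => Real.exp (φ p) * F p) q =
        Real.exp (φ q) * (spray F φ q * (dY i φ q * F q + dY i F q) +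
        (spray F (dY i φ) q * F q + dY i φ q * spray F F q + spray F (dY i F) q)) := by
      simp only [spray_eq_fderiv]
      exact fderiv_dY_exp_mul hU hF hφ hq i _
    rw [e2] at e4
    rw [spray_eq, e3] at e1
    rw [spray_eq F (dY i fun p => Real.exp (φ p) * F p)] at e4
    linear_combination (Real.exp (φ q) * F q) ^ 3 * (e4 - e1)
  have hb := cube_mul_hessian hU h'.homog hq (h'.ne_zero hq)
  have b00 := hb 0 0
  have b01 := hb 0 1
  have b10 := hb 1 0
  have b11 := hb 1 1
  have k0 := key 0
  have k1 := key 1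
  rw [h.spray_self hq] at k0 k1
  rw [h.detMetric_exp_mul hφ hq] at b00 b01 b10 b11
  clear key hb
  set T := spray F φ q * (dY 0 φ q * mUp F 0 q + dY 1 φ q * mUp F 1 q) +
        ((spray F (dY 0 φ) q - dX 0 φ q) * mUp F 0 q +
          (spray F (dY 1 φ) q - dX 1 φ q) * mUp F 1 q) with hT
  set D := perp q 0 * (sprayCoeff (fun p => Real.exp (φ p) * F p) 0 q - sprayCoeff F 0 q) +
      perp q 1 * (sprayCoeff (fun p => Real.exp (φ p) * F p) 1 q - sprayCoeff F 1 q) with hD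
  have k : 2 * (ε * (rho F φ q)⁻¹ * Real.exp (φ q) ^ 4 * detMetric F q) * D *
      (mScale ε F q * F q) = Real.exp (φ q) ^ 4 * F q ^ 4 * T := by
    rw [← hn, hD, hT]
    linear_combination mUp F 0 q * k0 + mUp F 1 q * k1 +
      (Real.exp (φ q) * F q) ^ 3 * Real.exp (φ q) * spray F φ q * hm
      - 2 * (sprayCoeff (fun p => Real.exp (φ p) * F p) 0 q - sprayCoeff F 0 q) *
        (mUp F 0 q * b00 + mUp F 1 q * b01)
      - 2 * (sprayCoeff (fun p => Real.exp (φ p) * F p) 1 q - sprayCoeff F 1 q) *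
        (mUp F 0 q * b10 + mUp F 1 q * b11)
  have k' : 2 * ε * detMetric F q * D * mScale ε F q = 2 * Q F φ q * F q := by
    rw [hQ]
    field_simp at k
    linear_combination k
  linear_combination (1 / 2) * mScale ε F q * k' - ε * D * hμ - D * hε

end IsFinsler

/-! ### The Landsberg scalar of the changed metric -/

namespace IsFinsler

/-- The spray of `F̄` on functions of degree `0`: the component along `y` of the difference of the
two sprays does not contribute. -/
theorem mul_spray_exp_mul (h : IsFinsler U ε F) (hφ : IsHomog U 0 φ)
    (h' : IsFinsler U ε fun p => Real.exp (φ p) * F p) (hf : IsHomog U 0 f) (hq : q ∈ U) :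
    F q * spray (fun p => Real.exp (φ p) * F p) f q =
      F q ^ 2 * h1 F f q - 2 * ε * Q F φ q * v2 F f q := by
  have hD := h.perp_mul_sprayCoeff_sub hφ h' hq
  have hn := h.perp_mul_mUp hq
  have e := euler_of_isHomog h.conic hf hq
  have hs := h.mul_h1 hq f
  have hμ0 := h.mScale_ne_zero hq
  have h0 := h.ne_zero hq
  norm_num at e
  simp only [perp, Matrix.cons_val_zero, Matrix.cons_val_one] at hD hn
  have key : (sprayCoeff (fun p => Real.exp (φ p) * F p) 0 q - sprayCoeff F 0 q) * dY 0 f q +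
      (sprayCoeff (fun p => Real.exp (φ p) * F p) 1 q - sprayCoeff F 1 q) * dY 1 f q =
      Q F φ q * (dY 0 f q * mUp F 0 q + dY 1 f q * mUp F 1 q) := by
    refine mul_left_cancel₀ (mul_ne_zero hμ0 h0) ?_
    generalize sprayCoeff (fun p => Real.exp (φ p) * F p) 0 q - sprayCoeff F 0 q = D₀ at *
    generalize sprayCoeff (fun p => Real.exp (φ p) * F p) 1 q - sprayCoeff F 1 q = D₁ at *
    linear_combination (dY 0 f q * mUp F 0 q + dY 1 f q * mUp F 1 q) * hD -
      (D₀ * dY 0 f q + D₁ * dY 1 f q) * hn + (D₀ * mUp F 1 q - D₁ * mUp F 0 q) * e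
  rw [spray_eq] at hs ⊢
  rw [h.v2_eq hq]
  linear_combination -F q * hs - 2 * F q * key +
    2 * Q F φ q * F q * (dY 0 f q * mUp F 0 q + dY 1 f q * mUp F 1 q) * h.sq_sign

theorem landsberg_exp_mul (h : IsFinsler U ε F) (hφ : IsHomog U 0 φ)
    (h' : IsFinsler U ε fun p => Real.exp (φ p) * F p) (hq : q ∈ U) :
    F q * landsberg (fun p => Real.exp (φ p) * F p) q =
      F q * √(ε * rho F φ q) * landsberg F q +
        √(ε * rho F φ q) / (2 * rho F φ q) *
          ((F q ^ 2 * h1 F (rho F φ) q - 2 * ε * Q F φ q * v2 F (rho F φ) q) *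
              (mainScalar F q + 2 * ε * v2 F φ q + ε * v2 F (rho F φ) q / (2 * rho F φ q)) +
            F q ^ 2 * (4 * ε * rho F φ q * h1 F (v2 F φ) q - ε * h1 F (v2 F (rho F φ)) q) -
            2 * Q F φ q * (2 * ε * rho F φ q * v2 F (mainScalar F) q +
              4 * rho F φ q * v2 F (v2 F φ) q - v2 F (v2 F (rho F φ)) q)) := by
  have hU := h.conic
  have hI := h.isHomog_mainScalar
  have hv := h.isHomog_v2 hφ
  have hr := h.isHomog_rho hφ h'
  have hw := h.isHomog_v2 hr
  have hr0 := h.rho_ne_zero hφ h' hq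
  have hpos := h.sign_mul_rho_pos hφ h' hq
  have hε := h.sq_sign
  have hk : IsHomog U 0 fun p => (rho F φ p)⁻¹ := hr.inv fun p hp => h.rho_ne_zero hφ h' hp
  have hεr : IsHomog U 0 fun p => ε * rho F φ p := (IsHomog.const ε).mul hr
  have hR : IsHomog U 0 fun p => √(ε * rho F φ p) :=
    hεr.sqrt fun p hp => (h.sign_mul_rho_pos hφ h' hp).ne'
  have hIv : IsHomog U 0 fun p => mainScalar F p + 2 * ε * v2 F φ p :=
    hI.add ((IsHomog.const (2 * ε)).mul hv)
  have hwk : IsHomog U 0 fun p => v2 F (rho F φ) p * (rho F φ p)⁻¹ := hw.mul hk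
  have hwk' : IsHomog U 0 fun p => ε / 2 * (v2 F (rho F φ) p * (rho F φ p)⁻¹) :=
    (IsHomog.const (ε / 2)).mul hwk
  have hIbar : Set.EqOn (mainScalar fun p => Real.exp (φ p) * F p)
      (fun p => √(ε * rho F φ p) * ((mainScalar F p + 2 * ε * v2 F φ p) -
        ε / 2 * (v2 F (rho F φ) p * (rho F φ p)⁻¹))) U := fun p hp => by
    rw [h.mainScalar_exp_mul hφ h' hp]
    simp only [div_eq_mul_inv, mul_inv]
    ring
  -- `w` is the spray of `F̄`, along which the formula for its main scalar is differentiated.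
  set w := sprayVec (fun p => Real.exp (φ p) * F p) q
  have hsqrt : 2 * √(ε * rho F φ q) * fderiv ℝ (fun p => √(ε * rho F φ p)) q w =
      ε * fderiv ℝ (rho F φ) q w := by
    have e : fderiv ℝ (fun p => √(ε * rho F φ p) * √(ε * rho F φ p)) q w =
        fderiv ℝ (fun p => ε * rho F φ p) q w := by
      rw [fderiv_eq_of_eqOn hU (fun p hp => Real.mul_self_sqrt
        (h.sign_mul_rho_pos hφ h' hp).le) hq]
    rw [fderiv_mul_apply hU hR hR hq, fderiv_mul_apply hU (IsHomog.const ε) hr hq] at e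
    simp at e
    linear_combination e
  have hinv : fderiv ℝ (fun p => (rho F φ p)⁻¹) q w =
      -fderiv ℝ (rho F φ) q w / rho F φ q ^ 2 := by
    have e : fderiv ℝ (fun p => rho F φ p * (rho F φ p)⁻¹) q w = 0 := by
      rw [fderiv_eq_of_eqOn hU (g := fun _ => 1)
        (fun p hp => mul_inv_cancel₀ (h.rho_ne_zero hφ h' hp)) hq]
      simp
    rw [fderiv_mul_apply hU hr hk hq] at e
    field_simp at e ⊢
    linear_combination e
  have hd : landsberg (fun p => Real.exp (φ p) * F p) q =
      fderiv ℝ (fun p => √(ε * rho F φ p)) q w * ((mainScalar F q + 2 * ε * v2 F φ q) -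
        ε / 2 * (v2 F (rho F φ) q * (rho F φ q)⁻¹)) +
      √(ε * rho F φ q) * ((fderiv ℝ (mainScalar F) q w + 2 * ε * fderiv ℝ (v2 F φ) q w) -
        ε / 2 * (fderiv ℝ (v2 F (rho F φ)) q w * (rho F φ q)⁻¹ +
          v2 F (rho F φ) q * fderiv ℝ (fun p => (rho F φ p)⁻¹) q w)) := by
    rw [landsberg, spray_eq_fderiv, fderiv_eq_of_eqOn hU hIbar hq,
      fderiv_mul_apply hU hR (hIv.sub hwk') hq,
      fderiv_fun_sub (hIv.differentiableAt hU hq) (hwk'.differentiableAt hU hq), sub_apply,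
      fderiv_fun_add (hI.differentiableAt hU hq)
        (((IsHomog.const (2 * ε)).mul hv).differentiableAt hU hq), add_apply,
      fderiv_mul_apply hU (IsHomog.const (2 * ε)) hv hq,
      fderiv_mul_apply hU (IsHomog.const (ε / 2)) hwk hq, fderiv_mul_apply hU hw hk hq]
    simp [w]
  have lI := h.mul_spray_exp_mul hφ h' hI hq
  have lv := h.mul_spray_exp_mul hφ h' hv hq
  have lr := h.mul_spray_exp_mul hφ h' hr hq
  have lw := h.mul_spray_exp_mul hφ h' hw hq
  have hJ := h.mul_h1 hq (mainScalar F)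
  rw [spray_eq_fderiv] at lI lv lr lw
  have hsq := Real.sq_sqrt hpos.le
  have hR0 := (Real.sqrt_pos.2 hpos).ne'
  have hsqrt' : fderiv ℝ (fun p => √(ε * rho F φ p)) q w =
      √(ε * rho F φ q) * fderiv ℝ (rho F φ) q w / (2 * rho F φ q) := by
    refine mul_left_cancel₀ (mul_ne_zero two_ne_zero hR0) ?_
    rw [hsqrt]
    field_simp
    rw [hsq]
    ring
  rw [hd, hinv, hsqrt', ← lr, landsberg, ← hJ]
  have lI' : F q * (F q * h1 F (mainScalar F) q) =
    F q * fderiv ℝ (mainScalar F) q w + 2 * ε * Q F φ q * v2 F (mainScalar F) q := by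
    rw [lI]; ring
  have lv' : F q ^ 2 * h1 F (v2 F φ) q =
    F q * fderiv ℝ (v2 F φ) q w + 2 * ε * Q F φ q * v2 F (v2 F φ) q := by
    rw [lv]; ring
  have lw' : F q ^ 2 * h1 F (v2 F (rho F φ)) q =
    F q * fderiv ℝ (v2 F (rho F φ)) q w + 2 * ε * Q F φ q * v2 F (v2 F (rho F φ)) q := by
    rw [lw]; ring
  clear lI lv lr lw hJ hd hinv hsqrt hsqrt' hIbar hwk' hwk hIv hR hεr hk
  generalize √(ε * rho F φ q) = R at *
  generalize fderiv ℝ (rho F φ) q w = r' at *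
  generalize fderiv ℝ (mainScalar F) q w = I' at *
  generalize fderiv ℝ (v2 F φ) q w = v' at *
  generalize fderiv ℝ (v2 F (rho F φ)) q w = w' at *
  generalize h1 F (mainScalar F) q = hI1 at *
  generalize h1 F (v2 F φ) q = hv1 at *
  generalize h1 F (v2 F (rho F φ)) q = hw1 at *
  generalize v2 F (mainScalar F) q = vI at *
  generalize v2 F (v2 F φ) q = vv at *
  generalize v2 F (v2 F (rho F φ)) q = vw at *
  generalize v2 F φ q = v at *
  generalize v2 F (rho F φ) q = w0 at *
  generalize rho F φ q = ρ at *
  generalize mainScalar F q = I at *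
  generalize F q = F' at *
  generalize Q F φ q = Q' at *
  field_simp
  linear_combination -4 * ρ ^ 2 * lI' - 8 * ρ ^ 2 * ε * lv' + 2 * ρ * ε * lw' +
    (4 * ρ * Q' * vw - 16 * ρ ^ 2 * Q' * vv) * hε

end IsFinsler

theorem IsConicOpen.inter_pos (hU : IsConicOpen U) (hf : IsHomog U 0 f) :
    IsConicOpen {q | q ∈ U ∧ 0 < f q} where
  isOpen := hf.smooth.continuousOn.isOpen_inter_preimage hU.isOpen isOpen_Ioi
  smul_mem q hq c hc := ⟨hU.smul_mem q hq.1 c hc, by simpa [hf.smul q hq.1 c hc] using hq.2⟩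

theorem isFinsler_of_isHomog (hU : IsConicOpen U) (hF : IsHomog U 1 F) (hε : ε = 1 ∨ ε = -1) :
    IsFinsler {q | q ∈ U ∧ 0 < ε * detMetric F q} ε F where
  conic := hU.inter_pos ((IsHomog.const ε).mul (isHomog_detMetric hU hF))
  homog := hF.mono fun _ hq => hq.1
  sign := hε
  pos _ hq := hq.2

theorem IsFinsler.mono {V : Set (Plane × Plane)} (h : IsFinsler U ε F) (hV : IsConicOpen V)
    (hVU : V ⊆ U) : IsFinsler V ε F :=
  ⟨hV, h.homog.mono hVU, h.sign, fun q hq => h.pos q (hVU hq)⟩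

/-- If `ε ρ > 0` at `q`, both `F` and `e^φ F` are metrics of signature `ε` on a conic neighbourhood
of `q`. -/
theorem exists_isFinsler_exp_mul (hU : IsConicOpen U) (hF : IsHomog U 1 F) (hφ : IsHomog U 0 φ)
    (hq : q ∈ U) (hε : ε = 1 ∨ ε = -1) (hpos : 0 < ε * detMetric F q)
    (hρ : 0 < ε * rho F φ q) :
    ∃ V, q ∈ V ∧ IsFinsler V ε F ∧ IsFinsler V ε (fun p => Real.exp (φ p) * F p) ∧
      IsHomog V 0 φ := by
  have h := isFinsler_of_isHomog hU hF hε
  have hφ₁ := hφ.mono (V := {q | q ∈ U ∧ 0 < ε * detMetric F q}) fun _ hq => hq.1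
  have hbar := isFinsler_of_isHomog h.conic (isHomog_exp_mul h.homog hφ₁) hε
  have hinv : 0 < ε * (rho F φ q)⁻¹ := by
    have h1 := inv_pos.2 hρ
    rcases hε with rfl | rfl <;> simpa using h1
  have hposbar : 0 < ε * detMetric (fun p => Real.exp (φ p) * F p) q := by
    rw [h.detMetric_exp_mul hφ₁ ⟨hq, hpos⟩]
    have : 0 < (ε * (rho F φ q)⁻¹) * (Real.exp (φ q) ^ 4 * (ε * detMetric F q)) := by positivity
    convert this using 1
    ring
  exact ⟨{p | p ∈ {p | p ∈ U ∧ 0 < ε * detMetric F p} ∧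
      0 < ε * detMetric (fun p => Real.exp (φ p) * F p) p}, ⟨⟨hq, hpos⟩, hposbar⟩,
    h.mono hbar.conic fun _ hq => hq.1, hbar, hφ₁.mono fun _ hq => hq.1⟩

/-! ### Passage from the surface to a chart -/

section Surface

variable {M : Type*} [TopologicalSpace M] [ChartedSpace Plane M] [IsManifold (𝓡 2) ∞ M]

theorem isConicOpen_setOf_isCoord {e : OpenPartialHomeomorph M Plane}
    (he : e ∈ IsManifold.maximalAtlas (𝓡 2) ∞ M) {A : Set (TangentBundle (𝓡 2) M)}
    (hA : IsConicSubbundle A) : IsConicOpen {q | IsCoord e A q} where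
  isOpen := isOpen_setOf_isCoord he hA.isOpen
  smul_mem q hq c hc := ⟨hq.1, by rw [tangentVec_smul]; exact hA.smul_mem _ hq.2 c hc⟩

theorem isHomog_inChart {e : OpenPartialHomeomorph M Plane}
    (he : e ∈ IsManifold.maximalAtlas (𝓡 2) ∞ M) {A : Set (TangentBundle (𝓡 2) M)} {r : ℕ}
    {f : TangentBundle (𝓡 2) M → ℝ} (hf : ContMDiffOn (𝓡 2).tangent 𝓘(ℝ, ℝ) ∞ f A)
    (hr : IsPosHomogeneous A r f) : IsHomog {q | IsCoord e A q} r (inChart e f) where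
  smooth := contDiffOn_inChart he hf
  smul q hq c hc := by
    rw [inChart, tangentVec_smul, hr _ hq.2 c hc, inChart, zpow_natCast]

end Surface

end FinslerSurface

end

theorem mainTheorem7 {M : Type*} [TopologicalSpace M] [ChartedSpace FinslerSurface.Plane M]
    [IsManifold (𝓡 2) ∞ M]
    (A : Set (TangentBundle (𝓡 2) M)) (F φ : TangentBundle (𝓡 2) M → ℝ)
    (hF : FinslerSurface.IsConicPseudoFinsler A F)
    (hφ : FinslerSurface.IsConformalFactor A F φ) :
    ∀ e ∈ IsManifold.maximalAtlas (𝓡 2) ∞ M, ∀ p, FinslerSurface.IsCoord e A p →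
      let f := FinslerSurface.inChart e F
      let ψ := FinslerSurface.inChart e φ
      let fbar := FinslerSurface.inChart e (FinslerSurface.conformalChange F φ)
      let ε := FinslerSurface.eps f p
      let I := FinslerSurface.mainScalar f
      let J := FinslerSurface.landsberg f
      let Jbar := FinslerSurface.landsberg fbar
      let ρ := FinslerSurface.rho f ψ
      let Q := FinslerSurface.Q f ψ
      let D₂ := FinslerSurface.v2 f
      let H₁ := FinslerSurface.h1 f
      0 < ε * ρ p →
      f p * Jbar p =
        f p * √(ε * ρ p) * J p +
          √(ε * ρ p) / (2 * ρ p) *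
            ((f p ^ 2 * H₁ ρ p - 2 * ε * Q p * D₂ ρ p) *
                (I p + 2 * ε * D₂ ψ p + ε * D₂ ρ p / (2 * ρ p)) +
              f p ^ 2 * (4 * ε * ρ p * H₁ (D₂ ψ) p - ε * H₁ (D₂ ρ) p) -
              2 * Q p * (2 * ε * ρ p * D₂ I p + 4 * ρ p * D₂ (D₂ ψ) p - D₂ (D₂ ρ) p)) := by
  intro e he p hp f ψ fbar ε I J Jbar ρ Q D₂ H₁ hρ
  have hd := hF.nondegenerate e he p hp
  obtain ⟨V, hpV, h, hbar, hψ⟩ := FinslerSurface.exists_isFinsler_exp_mul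
    (FinslerSurface.isConicOpen_setOf_isCoord he hF.conic)
    (FinslerSurface.isHomog_inChart he hF.smooth hF.homogeneous)
    (FinslerSurface.isHomog_inChart he hφ.smooth hφ.homogeneous) hp
    (Real.sign_apply_eq_of_ne_zero _ hd).symm (Real.sign_mul_pos_of_ne_zero _ hd) hρ
  exact h.landsberg_exp_mul hψ hbar hpV
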